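/- Let $\beta>0$ and let $H$ be a complex Hilbert space. Let $A:D(A)\subset H\to H$ be the generator of an exponentially stable $C_0$-semigroup $(T(t))_{t\ge 0}$ on $H$, and suppose that $A$ has a (countable) Riesz basis $(\phi_k)$ of eigenvectors, $A\phi_k=\lambda_k\phi_k$ with $\operatorname{Re}\lambda_k<0$. Here $(\phi_k)$ is a Riesz basis if its linear span is dense in $H$ and there are $c,C>0$ with $c\sum|a_k|^2\le\|\sum a_k\phi_k\|^2\le C\sum|a_k|^2$ for all finite families $(a_k)$. Let $D(A^*)'$ be the space of bounded conjugate-linear functionals on $D(A^*)$ with the graph norm; it contains $H$ through $x\mapsto\langle x,\cdot\rangle$, and $T(t)$ extends to it by $\langle T(t)f,y\rangle=\langle f,T(t)^*y\rangle$. Let $B:\mathbb C\to D(A^*)'$ be a bounded linear map, and let $(g_k)$ be the sequence of coefficients of $B$, that is, $B1=\sum_k g_k\phi_k$ in $D(A^*)'$. Let $\mathcal H^2_\beta=\mathcal H^2_\beta(0,\infty)$ be the space of those $f\in L^2(0,\infty)$, extended by zero to $\mathbb R$, whose fractional derivative $(d/dx)^\beta f$, defined by the Fourier multiplier $(i\omega)^\beta$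 on $\mathbb R$ ($\omega$ the angular frequency, principal branch), lies in $L^2$. For $u\in\mathcal H^2_\beta$ put $\mathcal B_\infty u=\int_0^\infty T(t)Bu(t)\,dt\in D(A^*)'$. Write $$p(z,w)=\left|\frac{z-w}{z+\overline w}\right|,\qquad b_{\infty,k}=\prod_{j\neq k}p(\lambda_j,\lambda_k),$$ and for an interval $I\subset i\mathbb R$ of length $|I|$ put $Q_I=\{x+iy: iy\in I,\ 0<x<|I|\}$. Then the following statements are equivalent. 1. The system $\dot x(t)=Ax(t)+Bu(t)$ is exactly controllable with respect to $\mathcal H^2_\beta$, that is, $H\subset\mathcal B_\infty(\mathcal H^2_\beta)$. 2. There is a constant $\kappa>0$ such that $$\sum_{-\lambda_k\in Q_I}\frac{|2\operatorname{Re}\lambda_k|^2\,|1-\lambda_k|^{2\beta}}{|b_{\infty,k}|^2\,|g_k|^2}\le\kappa|I|\qquad\text{for all intervals } I\subset i\mathbb R,$$ where a term with vanishing denominator is read as $+\infty$. -/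

import Mathlib

noncomputable section

namespace DiagonalControl

open MeasureTheory Filter Topology Set
open scoped NNReal ENNReal FourierTransform LinearPMap ComplexConjugate

/-- A strongly continuous one-parameter semigroup of bounded operators on `H`. -/
structure C0Semigroup (H : Type*) [NormedAddCommGroup H] [InnerProductSpace ℂ H] where
  toFun : ℝ≥0 → H →L[ℂ] H
  map_zero : toFun 0 = ContinuousLinearMap.id ℂ H
  map_add : ∀ s t, toFun (s + t) = (toFun s).comp (toFun t)
  strongly_continuous : ∀ x, Continuous fun t => toFun t x

/-- `‖T(t)‖ ≤ M e^{-ω t}` for some `M, ω > 0`. -/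
def C0Semigroup.ExponentiallyStable {H : Type*} [NormedAddCommGroup H] [InnerProductSpace ℂ H]
    (T : C0Semigroup H) : Prop :=
  ∃ M > 0, ∃ ω > 0, ∀ t : ℝ≥0, ‖T.toFun t‖ ≤ M * Real.exp (-ω * t)

/-- `A` is the infinitesimal generator of `T`: one has `x ∈ D(A)` and `A x = y` if and only if
`(T(t) x - x) / t → y` as `t → 0+`. -/
def IsGenerator {H : Type*} [NormedAddCommGroup H] [InnerProductSpace ℂ H]
    (A : H →ₗ.[ℂ] H) (T : C0Semigroup H) : Prop :=
  ∀ x y : H, (x, y) ∈ A.graph ↔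
    Tendsto (fun t : ℝ≥0 => (t : ℝ)⁻¹ • (T.toFun t x - x)) (𝓝[>] 0) (𝓝 y)

/-- A Riesz basis: a family with dense span on which the norm is equivalent to the `ℓ²` norm of
the coefficients. -/
def IsRieszBasis {ι H : Type*} [NormedAddCommGroup H] [InnerProductSpace ℂ H]
    (φ : ι → H) : Prop :=
  (Submodule.span ℂ (range φ)).topologicalClosure = ⊤ ∧
    ∃ c > 0, ∃ C > 0, ∀ a : ι →₀ ℂ,
      c * (∑ k ∈ a.support, ‖a k‖ ^ 2) ≤ ‖∑ k ∈ a.support, a k • φ k‖ ^ 2 ∧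
        ‖∑ k ∈ a.support, a k • φ k‖ ^ 2 ≤ C * (∑ k ∈ a.support, ‖a k‖ ^ 2)

section Extrapolation

variable {H : Type*} [NormedAddCommGroup H] [InnerProductSpace ℂ H] [CompleteSpace H]

/-- The domain `D(A*)` with its graph norm, realised as the graph of the adjoint `A*`. -/
abbrev AdjointDomain (A : H →ₗ.[ℂ] H) : Type _ := ↥(A†.graph)

/-- The extrapolation space `D(A*)'`: the bounded conjugate-linear functionals on `D(A*)`. -/
abbrev Extrapolation (A : H →ₗ.[ℂ] H) : Type _ := AdjointDomain A →L⋆[ℂ] ℂ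

/-- The embedding `H → D(A*)'`; it sends `x` to the functional `y ↦ ⟨x, y⟩` (linear in `x`,
conjugate-linear in `y`). -/
def embed (A : H →ₗ.[ℂ] H) (x : H) : Extrapolation A :=
  ((innerSL ℂ).flip x).comp
    ((ContinuousLinearMap.fst ℂ H H).comp (A†.graph).subtypeL)

theorem embed_apply (A : H →ₗ.[ℂ] H) (x : H) (y : AdjointDomain A) :
    embed A x y = inner ℂ y.1.1 x := rfl

theorem IsGenerator.semigroup_mem_graph {A : H →ₗ.[ℂ] H} {T : C0Semigroup H}
    (hA : IsGenerator A T) (t : ℝ≥0) {x y : H} (h : (x, y) ∈ A.graph) :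
    (T.toFun t x, T.toFun t y) ∈ A.graph := by
  rw [hA] at h ⊢
  have h2 := ((T.toFun t).continuous.tendsto y).comp h
  refine h2.congr fun s => ?_
  have e : T.toFun s (T.toFun t x) = T.toFun t (T.toFun s x) := by
    rw [← ContinuousLinearMap.comp_apply, ← ContinuousLinearMap.comp_apply, ← T.map_add,
      ← T.map_add, add_comm]
  simp only [Function.comp_apply, e]
  rw [← map_sub]
  exact (T.toFun t).map_smul_of_tower _ _

/-- `T(t)*` maps `D(A*)` into itself and commutes with `A*` there. -/
theorem IsGenerator.adjoint_mem_graph {A : H →ₗ.[ℂ] H} {T : C0Semigroup H}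
    (hA : IsGenerator A T) (t : ℝ≥0) {p : H × H} (hp : p ∈ A†.graph) :
    ((T.toFun t).adjoint p.1, (T.toFun t).adjoint p.2) ∈ A†.graph := by
  obtain ⟨y, h1, h2⟩ := (LinearPMap.mem_graph_iff _).1 hp
  by_cases hd : Dense (A.domain : Set H)
  · have key : ∀ x : A.domain, inner ℂ ((T.toFun t).adjoint p.2) (x : H)
        = inner ℂ ((T.toFun t).adjoint p.1) (A x) := by
      intro x
      obtain ⟨z, hz1, hz2⟩ := (LinearPMap.mem_graph_iff _).1
        (hA.semigroup_mem_graph t (A.mem_graph x))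
      simp only at hz1 hz2
      rw [ContinuousLinearMap.adjoint_inner_left, ContinuousLinearMap.adjoint_inner_left,
        ← hz1, ← hz2, ← h1, ← h2]
      exact LinearPMap.adjoint_isFormalAdjoint hd y z
    have hm := LinearPMap.mem_adjoint_domain_of_exists (T := A) _ ⟨_, key⟩
    exact (LinearPMap.mem_graph_iff _).2 ⟨⟨_, hm⟩, rfl, LinearPMap.adjoint_apply_eq hd _ key⟩
  · have h0 : p.2 = 0 := by rw [← h2, LinearPMap.adjoint_apply_of_not_dense hd]
    have hm : (T.toFun t).adjoint p.1 ∈ A†.domain := by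
      rw [LinearPMap.mem_adjoint_domain_iff]
      have hy := (LinearPMap.mem_adjoint_domain_iff _ _).1 (h1 ▸ y.2)
      let f : A.domain → A.domain := fun x =>
        ⟨T.toFun t x, LinearPMap.mem_domain_of_mem_graph
          (hA.semigroup_mem_graph t (A.mem_graph x))⟩
      have hf : Continuous f := by
        apply Continuous.subtype_mk
        fun_prop
      refine (hy.comp hf).congr fun x => ?_
      obtain ⟨z, hz1, hz2⟩ := (LinearPMap.mem_graph_iff _).1
        (hA.semigroup_mem_graph t (A.mem_graph x))
      have : f x = z := Subtype.ext hz1.symm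
      simp only [Function.comp_apply, this]
      change inner ℂ p.1 (A z) = inner ℂ ((T.toFun t).adjoint p.1) (A x)
      rw [ContinuousLinearMap.adjoint_inner_left, hz2]
    refine (LinearPMap.mem_graph_iff _).2 ⟨⟨_, hm⟩, rfl, ?_⟩
    rw [LinearPMap.adjoint_apply_of_not_dense hd, h0, map_zero]

/-- The restriction of `T(t)*` to `D(A*)`. -/
def adjointSemigroup {A : H →ₗ.[ℂ] H} {T : C0Semigroup H} (hA : IsGenerator A T) (t : ℝ≥0) :
    AdjointDomain A →L[ℂ] AdjointDomain A :=
  ((((T.toFun t).adjoint.prodMap (T.toFun t).adjoint)).comp (A†.graph).subtypeL).codRestrict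
    (A†.graph) fun p => hA.adjoint_mem_graph t p.2

/-- The extension of `T(t)` to `D(A*)'`, given by `⟨T(t) f, y⟩ = ⟨f, T(t)* y⟩`. -/
def extendedSemigroup {A : H →ₗ.[ℂ] H} {T : C0Semigroup H} (hA : IsGenerator A T) (t : ℝ≥0)
    (f : Extrapolation A) : Extrapolation A :=
  f.comp (adjointSemigroup hA t)

/-- The map so defined does extend `T(t)`. -/
theorem extendedSemigroup_embed {A : H →ₗ.[ℂ] H} {T : C0Semigroup H} (hA : IsGenerator A T)
    (t : ℝ≥0) (x : H) : extendedSemigroup hA t (embed A x) = embed A (T.toFun t x) := by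
  ext y
  exact ContinuousLinearMap.adjoint_inner_left _ _ _

end Extrapolation

/-- `g` is the fractional derivative `(d/dx)^β f`, defined through the Fourier transform
`𝓕 f (ξ) = ∫ f(t) e^{-2π i ξ t} dt` by the multiplier `(2π i ξ)^β` (principal branch). -/
def IsFractionalDeriv (β : ℝ) (f g : Lp ℂ 2 (volume : Measure ℝ)) : Prop :=
  (𝓕 g : Lp ℂ 2 (volume : Measure ℝ)) =ᵐ[volume] fun ξ : ℝ =>
    (2 * (Real.pi : ℂ) * Complex.I * (ξ : ℂ)) ^ (β : ℂ) *
      (𝓕 f : Lp ℂ 2 (volume : Measure ℝ)) ξ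

/-- The Sobolev space `H²_β(0,∞)`: the functions in `L²(0,∞)` (extended by zero to `ℝ`) whose
fractional derivative of order `β` is in `L²`. -/
def sobolevHalfLine (β : ℝ) : Set (Lp ℂ 2 (volume : Measure ℝ)) :=
  {f | (∀ᵐ t : ℝ, t < 0 → f t = 0) ∧ ∃ g : Lp ℂ 2 (volume : Measure ℝ), IsFractionalDeriv β f g}

/-- `𝓑_∞ u = ∫_0^∞ T(t) B u(t) dt`, an integral in `D(A*)'`. -/
def inputMap {H : Type*} [NormedAddCommGroup H] [InnerProductSpace ℂ H] [CompleteSpace H]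
    {A : H →ₗ.[ℂ] H} {T : C0Semigroup H} (hA : IsGenerator A T) (B : ℂ →L[ℂ] Extrapolation A)
    (u : ℝ → ℂ) : Extrapolation A :=
  ∫ t in Ioi (0 : ℝ), extendedSemigroup hA t.toNNReal (B (u t))

/-- Exact controllability with respect to `H²_β`: `H ⊆ 𝓑_∞ (H²_β)` inside `D(A*)'`. -/
def ExactlyControllable {H : Type*} [NormedAddCommGroup H] [InnerProductSpace ℂ H]
    [CompleteSpace H] {A : H →ₗ.[ℂ] H} {T : C0Semigroup H} (hA : IsGenerator A T)
    (B : ℂ →L[ℂ] Extrapolation A) (β : ℝ) : Prop :=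
  range (embed A) ⊆
    (fun u : Lp ℂ 2 (volume : Measure ℝ) => inputMap hA B u) '' sobolevHalfLine β

/-- The pseudo-hyperbolic distance `|(z - w) / (z + conj w)|`. -/
def pseudoHyperbolic (z w : ℂ) : ℝ := ‖(z - w) / (z + conj w)‖

/-- `b_{∞,k} = ∏_{j ≠ k} p(λ_j, λ_k)`. For `λ` in the open left half-plane all factors lie in
`[0, 1)`, so the product always converges, possibly to `0`. -/
def blaschkeProduct {ι : Type*} (lam : ι → ℂ) (k : ι) : ℝ :=
  ∏' j : {j : ι // j ≠ k}, pseudoHyperbolic (lam j) (lam k)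

/-- The Carleson square `Q_I = {x + i y : i y ∈ I, 0 < x < |I|}` over the interval `i I` of the
imaginary axis. -/
def carlesonSquare (I : Set ℝ) : Set ℂ :=
  {z | z.im ∈ I ∧ 0 < z.re ∧ ENNReal.ofReal z.re < volume I}

/-- The weighted Carleson condition for all intervals. The terms are taken in `[0, ∞]`, so that a
term whose denominator vanishes is infinite. -/
def WeightedCarleson {ι : Type*} (lam g : ι → ℂ) (β : ℝ) : Prop :=
  ∃ κ : ℝ≥0, 0 < κ ∧ ∀ I : Set ℝ, I.OrdConnected →
    ∑' k : {k : ι // -lam k ∈ carlesonSquare I},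
        ENNReal.ofReal (|2 * (lam k).re| ^ 2 * ‖1 - lam k‖ ^ (2 * β)) /
          ENNReal.ofReal (|blaschkeProduct lam k| ^ 2 * ‖g k‖ ^ 2)
      ≤ (κ : ℝ≥0∞) * volume I

end DiagonalControl

end

noncomputable section

namespace DiagonalControl

open MeasureTheory Filter Topology Set
open scoped NNReal ENNReal FourierTransform LinearPMap ComplexConjugate

/-! The eigenvectors turn the control problem into an interpolation problem. Write `z_k = -λ_k` and
let `û` be the Laplace transform of `u`. The extended semigroup multiplies `φ_k` by `e^{λ_k t}`, so
the input map sends `u` to `∑ g_k û(z_k) φ_k`, convergent in `D(A*)'` (`hasSum_inputMap`). A Riesz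
basis identifies `H` with `ℓ²`. The Laplace transforms of the Sobolev inputs are exactly the
functions `(1+z)^{-β} ĥ(z)` with `h` causal in `L²` (`exists_isCausal_laplace_of_mem_sobolev`,
`exists_mem_sobolev_laplace`). Exact controllability therefore says that `γ_k ĥ(z_k) = a_k` is
solvable for every `a ∈ ℓ²`, where `γ_k = g_k (1+z_k)^{-β}`. The theorem becomes a weighted
interpolation theorem for the Hardy space of the right half-plane: interpolation is possible exactly
when the masses `(2 Re z_k / (b_k |γ_k|))²` at the points `z_k` form a Carleson measure.

Necessity. The open mapping theorem makes interpolation norm-controlled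
(`exists_norm_le_of_interpolation`). For a finite set of nodes with Blaschke product `B_S`, the
function `1 / ((s + conj w) B_S(s))` has the modulus of a Cauchy kernel on the imaginary axis, and
its residues at the nodes have modulus `2 Re z_k / (b_{S,k} |z_k + conj w|)`. Pairing it with a
causal function bounds the corresponding sum of values (`exists_residue_pairing`). Data dual to the
residues give a reproducing-kernel test with right side `C / (2 Re w)` (`sum_le_of_interpolation`),
and `w` at height `|I|` over `I` gives the Carleson bound on `Q_I`.

Sufficiency. On finitely many nodes, `B_S(s) ∑ c_k / (s - z_k)` interpolates, and its norm is that
of `∑ c_k / (s - z_k)` because `B_S` is unimodular on the axis (`exists_finite_interpolant`). The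
dual Carleson embedding `norm_sum_cauchyKernel_sq_le` bounds that norm uniformly in `S`, and weak-*
compactness yields a solution for all nodes (`exists_of_forall_finset_inner`). The embedding is
proved directly: a Poisson-type kernel that dominates its own products is bounded on `ℓ²` once its
integrals are bounded. -/

/-! ### Fourier transforms of one-sided exponentials -/

/-- The Fourier transform on `L²` is given by the Fourier integral on `L¹ ∩ L²`. -/
theorem fourier_toLp_ae_eq {f : ℝ → ℂ} (h1 : Integrable f) (h2 : MemLp f 2) :
    (𝓕 (h2.toLp f) : Lp ℂ 2 (volume : Measure ℝ)) =ᵐ[volume] 𝓕 f := by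
  have hc : Continuous (𝓕 f) := by
    refine VectorFourier.fourierIntegral_continuous Real.continuous_fourierChar ?_ h1
    exact continuous_inner
  have hloc : LocallyIntegrable (𝓕 (h2.toLp f) : Lp ℂ 2 (volume : Measure ℝ)) volume :=
    (Lp.memLp _).locallyIntegrable (by norm_num)
  -- Both sides are compared as distributions: the `L²` transform agrees with the tempered one, and
  -- moving the transform onto the test function is Fubini for the integral.
  refine ae_eq_of_integral_contDiff_smul_eq hloc hc.locallyIntegrable fun φ hφ hφc => ?_
  have hφc' : HasCompactSupport (fun x => (φ x : ℂ)) := hφc.comp_left Complex.ofReal_zero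
  have hφ' : ContDiff ℝ ((⊤ : ℕ∞) : WithTop ℕ∞) (fun x => (φ x : ℂ)) :=
    Complex.ofRealCLM.contDiff.comp hφ
  let g : SchwartzMap ℝ ℂ := hφc'.toSchwartzMap hφ'
  have key := congrArg (fun S : TemperedDistribution ℝ ℂ => S g)
    (Lp.fourier_toTemperedDistribution_eq (h2.toLp f))
  simp only [TemperedDistribution.fourier_apply, Lp.toTemperedDistribution_apply] at key
  have e1 : ∀ x, φ x • (𝓕 (h2.toLp f) : Lp ℂ 2 (volume : Measure ℝ)) x
      = g x • (𝓕 (h2.toLp f) : Lp ℂ 2 (volume : Measure ℝ)) x := fun x => by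
    rw [Complex.real_smul]; rfl
  have e2 : ∀ x, φ x • (𝓕 f) x = g x • (𝓕 f) x := fun x => by
    rw [Complex.real_smul]; rfl
  simp only [e1, e2]
  rw [← key]
  have := VectorFourier.integral_fourierIntegral_smul_eq_flip (L := innerₗ ℝ) (f := g) (g := f)
    (μ := volume) (ν := volume) Real.continuous_fourierChar continuous_inner g.integrable h1
  rw [flip_innerₗ] at this
  refine Eq.trans ?_ this
  refine integral_congr_ae ?_
  filter_upwards [h2.coeFn_toLp] with x hx
  rw [hx]
  rfl

theorem integral_fourier_mul_conj {f : ℝ → ℂ} (h1 : Integrable f) (h2 : MemLp f 2)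
    (u : Lp ℂ 2 (volume : Measure ℝ)) :
    ∫ ξ, (𝓕 u : Lp ℂ 2 (volume : Measure ℝ)) ξ * conj (𝓕 f ξ) = ∫ t, u t * conj (f t) := by
  have h := Lp.inner_fourier_eq (h2.toLp f) u
  rw [L2.inner_def, L2.inner_def] at h
  convert h using 1
  · refine integral_congr_ae ?_
    filter_upwards [fourier_toLp_ae_eq h1 h2] with x hx
    rw [hx]; rfl
  · refine integral_congr_ae ?_
    filter_upwards [h2.coeFn_toLp] with x hx
    rw [hx]; rfl

/-- The decaying exponential `e^{-z (t + s)}` on `t > -s`, extended by zero. -/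
def decayExp (z : ℂ) (s : ℝ) : ℝ → ℂ :=
  (Ioi (-s)).indicator fun t => Complex.exp (-z * (t + s))

/-- The growing exponential `e^{w (t + s)}` on `t ≤ -s`, extended by zero. -/
def growExp (w : ℂ) (s : ℝ) : ℝ → ℂ :=
  (Iic (-s)).indicator fun t => Complex.exp (w * (t + s))

theorem integrableOn_exp_affine_Ioi {z : ℂ} (hz : 0 < z.re) (s c : ℝ) :
    IntegrableOn (fun t : ℝ => Complex.exp (-z * (t + s))) (Ioi c) := by
  have h := (integrableOn_exp_mul_complex_Ioi (a := -z) (by simpa using hz) c).mul_const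
    (Complex.exp (-z * s))
  refine IntegrableOn.congr_fun h (fun t _ => ?_) measurableSet_Ioi
  simp only [← Complex.exp_add]; ring_nf

theorem integrableOn_exp_affine_Iic {w : ℂ} (hw : 0 < w.re) (s c : ℝ) :
    IntegrableOn (fun t : ℝ => Complex.exp (w * (t + s))) (Iic c) := by
  have h := (integrableOn_exp_mul_complex_Iic (a := w) hw c).mul_const (Complex.exp (w * s))
  refine IntegrableOn.congr_fun h (fun t _ => ?_) measurableSet_Iic
  simp only [← Complex.exp_add]; ring_nf

theorem integrable_decayExp {z : ℂ} (hz : 0 < z.re) (s : ℝ) : Integrable (decayExp z s) :=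
  (integrable_indicator_iff measurableSet_Ioi).2 (integrableOn_exp_affine_Ioi hz s _)

theorem integrable_growExp {w : ℂ} (hw : 0 < w.re) (s : ℝ) : Integrable (growExp w s) :=
  (integrable_indicator_iff measurableSet_Iic).2 (integrableOn_exp_affine_Iic hw s _)

theorem norm_exp_sq (a : ℂ) : ‖Complex.exp a‖ ^ 2 = ‖Complex.exp (2 * a)‖ := by
  rw [two_mul, Complex.exp_add, norm_mul, sq]

theorem memLp_decayExp {z : ℂ} (hz : 0 < z.re) (s : ℝ) : MemLp (decayExp z s) 2 := by
  rw [memLp_two_iff_integrable_sq_norm (integrable_decayExp hz s).aestronglyMeasurable]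
  refine (integrable_decayExp (z := 2 * z) (by simpa using hz) s).norm.congr ?_
  refine Eventually.of_forall fun t => ?_
  by_cases ht : t ∈ Ioi (-s)
  · simp only [decayExp, indicator_of_mem ht, norm_exp_sq]; ring_nf
  · simp [decayExp, indicator_of_notMem ht]

theorem memLp_growExp {w : ℂ} (hw : 0 < w.re) (s : ℝ) : MemLp (growExp w s) 2 := by
  rw [memLp_two_iff_integrable_sq_norm (integrable_growExp hw s).aestronglyMeasurable]
  refine (integrable_growExp (w := 2 * w) (by simpa using hw) s).norm.congr ?_
  refine Eventually.of_forall fun t => ?_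
  by_cases ht : t ∈ Iic (-s)
  · simp only [growExp, indicator_of_mem ht, norm_exp_sq]; ring_nf
  · simp [growExp, indicator_of_notMem ht]

/-- The angular frequency `2π i ξ`. -/
def freq (ξ : ℝ) : ℂ := 2 * (Real.pi : ℂ) * Complex.I * (ξ : ℂ)

theorem freq_re (ξ : ℝ) : (freq ξ).re = 0 := by simp [freq]

theorem conj_freq (ξ : ℝ) : conj (freq ξ) = -freq ξ := by
  simp [freq, Complex.conj_ofReal, map_ofNat]

theorem add_freq_ne_zero {z : ℂ} (hz : 0 < z.re) (ξ : ℝ) : z + freq ξ ≠ 0 := fun h => by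
  have := congrArg Complex.re h
  simp [freq_re] at this
  linarith

theorem sub_freq_ne_zero {z : ℂ} (hz : 0 < z.re) (ξ : ℝ) : z - freq ξ ≠ 0 := fun h => by
  have := congrArg Complex.re h
  simp [freq_re] at this
  linarith

theorem fourier_decayExp {z : ℂ} (hz : 0 < z.re) (s ξ : ℝ) :
    𝓕 (decayExp z s) ξ = Complex.exp (freq ξ * s) / (z + freq ξ) := by
  rw [Real.fourier_real_eq_integral_exp_smul]
  have e : (fun t : ℝ => Complex.exp (((-2 * Real.pi * t * ξ : ℝ) : ℂ) * Complex.I) •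
      decayExp z s t) = (Ioi (-s)).indicator fun t : ℝ =>
        Complex.exp (-(z + freq ξ) * t) * Complex.exp (-z * s) := by
    funext t
    by_cases ht : t ∈ Ioi (-s)
    · simp only [decayExp, indicator_of_mem ht, smul_eq_mul, ← Complex.exp_add]
      congr 1; push_cast; simp only [freq]; ring
    · simp [decayExp, indicator_of_notMem ht]
  rw [e, integral_indicator measurableSet_Ioi, integral_mul_const,
    integral_exp_mul_complex_Ioi (by simp [freq_re, hz])]
  have := add_freq_ne_zero hz ξ
  rw [neg_div_neg_eq, div_mul_eq_mul_div, ← Complex.exp_add]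
  congr 2; push_cast; ring

theorem fourier_growExp {w : ℂ} (hw : 0 < w.re) (s ξ : ℝ) :
    𝓕 (growExp w s) ξ = Complex.exp (freq ξ * s) / (w - freq ξ) := by
  rw [Real.fourier_real_eq_integral_exp_smul]
  have e : (fun t : ℝ => Complex.exp (((-2 * Real.pi * t * ξ : ℝ) : ℂ) * Complex.I) •
      growExp w s t) = (Iic (-s)).indicator fun t : ℝ =>
        Complex.exp ((w - freq ξ) * t) * Complex.exp (w * s) := by
    funext t
    by_cases ht : t ∈ Iic (-s)
    · simp only [growExp, indicator_of_mem ht, smul_eq_mul, ← Complex.exp_add]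
      congr 1; push_cast; simp only [freq]; ring
    · simp [growExp, indicator_of_notMem ht]
  rw [e, integral_indicator measurableSet_Iic, integral_mul_const,
    integral_exp_mul_complex_Iic (by simp [freq_re, hw])]
  rw [div_mul_eq_mul_div, ← Complex.exp_add]
  congr 2; push_cast; ring

/-- Pairing the Fourier transform with a Cauchy kernel of the left half-plane. -/
theorem integral_fourier_div_sub {z : ℂ} (hz : 0 < z.re) (s : ℝ)
    (u : Lp ℂ 2 (volume : Measure ℝ)) :
    ∫ ξ, (𝓕 u : Lp ℂ 2 (volume : Measure ℝ)) ξ * (Complex.exp (-freq ξ * s) / (z - freq ξ))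
      = ∫ t in Ioi (-s), u t * Complex.exp (-z * (t + s)) := by
  have hz' : 0 < (conj z).re := by simpa using hz
  have h := integral_fourier_mul_conj (integrable_decayExp hz' s) (memLp_decayExp hz' s) u
  simp only [fourier_decayExp hz'] at h
  rw [← integral_indicator measurableSet_Ioi]
  convert h using 1
  · congr 1; funext ξ
    simp only [map_div₀, ← Complex.exp_conj, map_mul, map_add, conj_freq, Complex.conj_conj,
      Complex.conj_ofReal, sub_eq_add_neg]
  · congr 1; funext t
    by_cases ht : t ∈ Ioi (-s)
    · simp only [decayExp, indicator_of_mem ht, ← Complex.exp_conj, map_mul, map_neg, map_add,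
        Complex.conj_conj, Complex.conj_ofReal]
    · simp [decayExp, indicator_of_notMem ht]

/-- Pairing the Fourier transform with a Cauchy kernel of the right half-plane. -/
theorem integral_fourier_div_add {w : ℂ} (hw : 0 < w.re) (s : ℝ)
    (u : Lp ℂ 2 (volume : Measure ℝ)) :
    ∫ ξ, (𝓕 u : Lp ℂ 2 (volume : Measure ℝ)) ξ * (Complex.exp (-freq ξ * s) / (w + freq ξ))
      = ∫ t in Iic (-s), u t * Complex.exp (w * (t + s)) := by
  have hz' : 0 < (conj w).re := by simpa using hw
  have h := integral_fourier_mul_conj (integrable_growExp hz' s) (memLp_growExp hz' s) u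
  simp only [fourier_growExp hz'] at h
  rw [← integral_indicator measurableSet_Iic]
  convert h using 1
  · congr 1; funext ξ
    simp only [map_div₀, ← Complex.exp_conj, map_mul, map_sub, conj_freq, Complex.conj_conj,
      Complex.conj_ofReal, sub_neg_eq_add]
  · congr 1; funext t
    by_cases ht : t ∈ Iic (-s)
    · simp only [growExp, indicator_of_mem ht, ← Complex.exp_conj, map_mul, map_add,
        Complex.conj_conj, Complex.conj_ofReal]
    · simp [growExp, indicator_of_notMem ht]

/-! ### The Gamma integral at complex argument -/

theorem integrableOn_rpow_mul_exp {q b : ℝ} (hq : -1 < q) (hb : 0 < b) :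
    IntegrableOn (fun t : ℝ => t ^ q * Real.exp (-b * t)) (Ioi 0) := by
  simpa using integrableOn_rpow_mul_exp_neg_mul_rpow (p := 1) hq one_pos hb

theorem integrableOn_rpow_mul_cexp {q : ℝ} (hq : -1 < q) {r : ℂ} (hr : 0 < r.re) :
    IntegrableOn (fun t : ℝ => ((t ^ q : ℝ) : ℂ) * Complex.exp (-r * t)) (Ioi 0) := by
  refine (integrableOn_rpow_mul_exp hq hr).mono' (by fun_prop) ?_
  filter_upwards [ae_restrict_mem measurableSet_Ioi] with t ht
  have : 0 ≤ t ^ q := Real.rpow_nonneg (le_of_lt ht) q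
  simp [Complex.norm_exp, abs_of_nonneg this]

theorem differentiableAt_gammaLaplace {q : ℝ} (hq : -1 < q) {r : ℂ} (hr : 0 < r.re) :
    DifferentiableAt ℂ (fun r : ℂ =>
      ∫ t in Ioi (0 : ℝ), ((t ^ q : ℝ) : ℂ) * Complex.exp (-r * t)) r := by
  have hs : {x : ℂ | r.re / 2 < x.re} ∈ 𝓝 r :=
    (isOpen_lt continuous_const Complex.continuous_re).mem_nhds (by simp; linarith)
  refine (hasDerivAt_integral_of_dominated_loc_of_deriv_le (μ := volume.restrict (Ioi (0 : ℝ)))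
    (F := fun r t => ((t ^ q : ℝ) : ℂ) * Complex.exp (-r * t))
    (F' := fun r t => ((t ^ q : ℝ) : ℂ) * (Complex.exp (-r * t) * (-t)))
    (bound := fun t => t ^ (q + 1) * Real.exp (-(r.re / 2) * t)) hs ?_ ?_ ?_ ?_ ?_ ?_).2.differentiableAt
  · exact Eventually.of_forall fun x => by fun_prop
  · exact integrableOn_rpow_mul_cexp hq hr
  · fun_prop
  · filter_upwards [ae_restrict_mem measurableSet_Ioi] with t ht x hx
    have ht : 0 < t := ht
    have h0 : 0 ≤ t ^ q := Real.rpow_nonneg ht.le q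
    simp only [norm_mul, Complex.norm_real, Real.norm_eq_abs, abs_of_nonneg h0, norm_neg,
      Complex.norm_exp, abs_of_pos ht, Real.rpow_add_one ht.ne']
    have : Real.exp ((-x * t).re) ≤ Real.exp (-(r.re / 2) * t) := by
      apply Real.exp_le_exp.2
      have hx : r.re / 2 < x.re := hx
      simp only [Complex.mul_re, Complex.neg_re, Complex.ofReal_re, Complex.ofReal_im, mul_zero,
        sub_zero]
      nlinarith
    calc _ ≤ t ^ q * (Real.exp (-(r.re / 2) * t) * t) := by gcongr
      _ = _ := by ring
  · exact integrableOn_rpow_mul_exp (by linarith) (by linarith)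
  · refine Eventually.of_forall fun t x _ => ?_
    have h : HasDerivAt (fun x : ℂ => -x * (t : ℂ)) (-t) x := by
      simpa using ((hasDerivAt_id x).neg.mul_const (t : ℂ))
    exact h.cexp.const_mul _

/-- The Laplace transform of `t^{γ-1}` at complex argument. -/
theorem integral_rpow_mul_cexp {γ : ℝ} (hγ : 0 < γ) {r : ℂ} (hr : 0 < r.re) :
    ∫ t in Ioi (0 : ℝ), ((t ^ (γ - 1) : ℝ) : ℂ) * Complex.exp (-r * t)
      = r ^ (-γ : ℂ) * (Real.Gamma γ : ℂ) := by
  have hU : IsOpen {r : ℂ | 0 < r.re} := isOpen_lt continuous_const Complex.continuous_re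
  have hpre : IsPreconnected {r : ℂ | 0 < r.re} := (convex_halfSpace_re_gt 0).isPreconnected
  have h1 : AnalyticOnNhd ℂ (fun r : ℂ =>
      ∫ t in Ioi (0 : ℝ), ((t ^ (γ - 1) : ℝ) : ℂ) * Complex.exp (-r * t)) {r : ℂ | 0 < r.re} :=
    DifferentiableOn.analyticOnNhd (fun r hr =>
      (differentiableAt_gammaLaplace (by linarith) hr).differentiableWithinAt) hU
  have h2 : AnalyticOnNhd ℂ (fun r : ℂ => r ^ (-γ : ℂ) * (Real.Gamma γ : ℂ))
      {r : ℂ | 0 < r.re} :=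
    DifferentiableOn.analyticOnNhd (fun r hr => by
      have : r ∈ Complex.slitPlane := Or.inl hr
      exact ((differentiableAt_id.cpow_const this).mul_const _).differentiableWithinAt) hU
  -- Identity theorem on the right half-plane: the real formula holds on the positive axis, which
  -- accumulates at `1`.
  refine h1.eqOn_of_preconnected_of_frequently_eq h2 hpre (z₀ := 1) (by simp) ?_ hr
  have hreal : ∀ x : ℝ, 0 < x →
      ∫ t in Ioi (0 : ℝ), ((t ^ (γ - 1) : ℝ) : ℂ) * Complex.exp (-(x : ℂ) * t)
        = (x : ℂ) ^ (-γ : ℂ) * (Real.Gamma γ : ℂ) := by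
    intro x hx
    have h := congrArg (fun a : ℝ => (a : ℂ)) (Real.integral_rpow_mul_exp_neg_mul_Ioi hγ hx)
    simp only [← integral_complex_ofReal] at h
    convert h using 1
    · congr 1; funext t; push_cast; ring_nf
    · rw [one_div, Real.inv_rpow hx.le, ← Real.rpow_neg hx.le, Complex.ofReal_mul,
        Complex.ofReal_cpow hx.le]
      simp
  have ht : Tendsto (fun x : ℝ => (x : ℂ)) (𝓝[≠] 1) (𝓝[≠] 1) := by
    refine tendsto_nhdsWithin_iff.2 ⟨?_, ?_⟩
    · exact (Complex.continuous_ofReal.tendsto' 1 1 (by simp)).mono_left nhdsWithin_le_nhds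
    · filter_upwards [self_mem_nhdsWithin] with x hx
      simpa using hx
  refine ht.frequently (Eventually.frequently ?_)
  filter_upwards [nhdsWithin_le_nhds (lt_mem_nhds (zero_lt_one' ℝ))] with x hx
  exact hreal x hx

/-! ### Causal functions and Laplace transforms -/

/-- The function vanishes almost everywhere on the negative half-line. -/
def IsCausal (u : Lp ℂ 2 (volume : Measure ℝ)) : Prop := ∀ᵐ t : ℝ, t < 0 → u t = 0

/-- The Laplace transform `∫_0^∞ u(t) e^{-zt} dt`. -/
def laplace (u : ℝ → ℂ) (z : ℂ) : ℂ := ∫ t in Ioi (0 : ℝ), u t * Complex.exp (-z * t)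

theorem exists_fourier_ae_eq {F : ℝ → ℂ} (hF : MemLp F 2) :
    ∃ f : Lp ℂ 2 (volume : Measure ℝ), (𝓕 f : Lp ℂ 2 (volume : Measure ℝ)) =ᵐ[volume] F := by
  refine ⟨𝓕⁻ (hF.toLp F), ?_⟩
  rw [FourierTransform.fourier_fourierInv_eq]
  exact hF.coeFn_toLp

theorem exists_fourier_ae_eq_mul {m : ℝ → ℂ} (hm : Measurable m) {C : ℝ} (hC : ∀ ξ, ‖m ξ‖ ≤ C)
    (h : Lp ℂ 2 (volume : Measure ℝ)) :
    ∃ f : Lp ℂ 2 (volume : Measure ℝ), (𝓕 f : Lp ℂ 2 (volume : Measure ℝ)) =ᵐ[volume]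
      fun ξ => m ξ * (𝓕 h : Lp ℂ 2 (volume : Measure ℝ)) ξ := by
  refine exists_fourier_ae_eq (MemLp.of_le_mul (c := C) (Lp.memLp (𝓕 h)) ?_ ?_)
  · exact hm.aestronglyMeasurable.mul (Lp.memLp _).aestronglyMeasurable
  · exact Eventually.of_forall fun ξ => by rw [norm_mul]; gcongr; exact hC ξ

theorem memLp_fourier {f : ℝ → ℂ} (h1 : Integrable f) (h2 : MemLp f 2) : MemLp (𝓕 f) 2 :=
  (memLp_congr_ae (fourier_toLp_ae_eq h1 h2)).1 (Lp.memLp _)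

theorem memLp_inv_add_freq {z : ℂ} (hz : 0 < z.re) : MemLp (fun ξ => (z + freq ξ)⁻¹) 2 := by
  have h := memLp_fourier (integrable_decayExp hz 0) (memLp_decayExp hz 0)
  refine (memLp_congr_ae (Eventually.of_forall fun ξ => ?_)).1 h
  simp [fourier_decayExp hz]

theorem memLp_inv_sub_freq {z : ℂ} (hz : 0 < z.re) : MemLp (fun ξ => (z - freq ξ)⁻¹) 2 := by
  have h := memLp_fourier (integrable_growExp hz 0) (memLp_growExp hz 0)
  refine (memLp_congr_ae (Eventually.of_forall fun ξ => ?_)).1 h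
  simp [fourier_growExp hz]

theorem integral_fourier_mul_inv_sub {z : ℂ} (hz : 0 < z.re)
    (u : Lp ℂ 2 (volume : Measure ℝ)) :
    ∫ ξ, (𝓕 u : Lp ℂ 2 (volume : Measure ℝ)) ξ * (z - freq ξ)⁻¹ = laplace u z := by
  simpa [laplace] using integral_fourier_div_sub hz 0 u

theorem integral_fourier_mul_inv_add {w : ℂ} (hw : 0 < w.re)
    (u : Lp ℂ 2 (volume : Measure ℝ)) :
    ∫ ξ, (𝓕 u : Lp ℂ 2 (volume : Measure ℝ)) ξ * (w + freq ξ)⁻¹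
      = ∫ t in Iic (0 : ℝ), u t * Complex.exp (w * t) := by
  simpa using integral_fourier_div_add hw 0 u

theorem memLp_exp_Iic {w : ℂ} (hw : 0 < w.re) :
    MemLp (fun t : ℝ => Complex.exp (w * t)) 2 (volume.restrict (Iic 0)) := by
  refine (memLp_congr_ae ?_).1 ((memLp_growExp hw 0).restrict (Iic 0))
  filter_upwards [ae_restrict_mem measurableSet_Iic] with t ht
  simpa [growExp] using ht

theorem memLp_exp_Ioi {z : ℂ} (hz : 0 < z.re) :
    MemLp (fun t : ℝ => Complex.exp (-z * t)) 2 (volume.restrict (Ioi 0)) := by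
  refine (memLp_congr_ae ?_).1 ((memLp_decayExp hz 0).restrict (Ioi 0))
  filter_upwards [ae_restrict_mem measurableSet_Ioi] with t ht
  simpa [decayExp] using ht

theorem integrableOn_mul_exp_Iic {w : ℂ} (hw : 0 < w.re) (u : Lp ℂ 2 (volume : Measure ℝ)) :
    IntegrableOn (fun t : ℝ => u t * Complex.exp (w * t)) (Iic 0) :=
  MemLp.integrable_mul ((Lp.memLp u).restrict _) (memLp_exp_Iic hw)

theorem integrableOn_mul_exp_Ioi {z : ℂ} (hz : 0 < z.re) (u : Lp ℂ 2 (volume : Measure ℝ)) :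
    IntegrableOn (fun t : ℝ => u t * Complex.exp (-z * t)) (Ioi 0) :=
  MemLp.integrable_mul ((Lp.memLp u).restrict _) (memLp_exp_Ioi hz)

theorem IsCausal.setIntegral_Iic {u : Lp ℂ 2 (volume : Measure ℝ)} (hu : IsCausal u)
    {c : ℝ} (hc : c ≤ 0) (κ : ℝ → ℂ) : ∫ t in Iic c, u t * κ t = 0 := by
  refine integral_eq_zero_of_ae ?_
  filter_upwards [ae_restrict_mem measurableSet_Iic, ae_restrict_of_ae hu,
    ae_restrict_of_ae (Measure.ae_ne volume (0 : ℝ))] with t ht h h0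
  have : t < 0 := lt_of_le_of_ne (le_trans ht hc) h0
  simp [h this]

/-- On the line `w = 1 - freq ξ` these pairings are the Fourier transform of `u(t) e^t` cut off to
`t ≤ 0`, so that function vanishes by injectivity of the transform on `L²`. -/
theorem isCausal_of_forall {u : Lp ℂ 2 (volume : Measure ℝ)}
    (h : ∀ w : ℂ, 0 < w.re → ∫ t in Iic (0 : ℝ), u t * Complex.exp (w * t) = 0) :
    IsCausal u := by
  let f : ℝ → ℂ := (Iic (0 : ℝ)).indicator fun t => u t * Complex.exp ((1 : ℂ) * t)
  have h1 : Integrable f :=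
    (integrable_indicator_iff measurableSet_Iic).2 (integrableOn_mul_exp_Iic (by simp) u)
  have h2 : MemLp f 2 := by
    refine (Lp.memLp u).of_le h1.aestronglyMeasurable (Eventually.of_forall fun t => ?_)
    by_cases ht : t ∈ Iic (0 : ℝ)
    · simp only [f, indicator_of_mem ht, norm_mul, Complex.norm_exp]
      have : Real.exp ((1 * (t : ℂ)).re) ≤ 1 := Real.exp_le_one_iff.2 (by simpa using ht)
      exact mul_le_of_le_one_right (norm_nonneg _) this
    · simp [f, indicator_of_notMem ht]
  have h3 : ∀ ξ, 𝓕 f ξ = 0 := by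
    intro ξ
    rw [Real.fourier_real_eq_integral_exp_smul, ← h (1 - freq ξ) (by simp [freq_re]),
      ← integral_indicator measurableSet_Iic]
    congr 1; funext t
    by_cases ht : t ∈ Iic (0 : ℝ)
    · simp only [f, indicator_of_mem ht, smul_eq_mul]
      rw [mul_left_comm, ← Complex.exp_add]
      congr 2; push_cast; simp only [freq]; ring
    · simp [f, indicator_of_notMem ht]
  have h4 : (𝓕 (h2.toLp f) : Lp ℂ 2 (volume : Measure ℝ)) = 0 := by
    rw [Lp.eq_zero_iff_ae_eq_zero]
    filter_upwards [fourier_toLp_ae_eq h1 h2] with ξ hξ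
    rw [hξ, h3]; rfl
  have h5 : h2.toLp f = 0 := by
    rw [← norm_eq_zero, ← Lp.norm_fourier_eq, h4, norm_zero]
  rw [Lp.eq_zero_iff_ae_eq_zero] at h5
  filter_upwards [h5, h2.coeFn_toLp] with t e1 e2 ht
  rw [e2] at e1
  have ht' : t ∈ Iic (0 : ℝ) := le_of_lt ht
  simpa [f, indicator_of_mem ht', Complex.exp_ne_zero] using e1

/-! ### Fractional powers of `1 + d/dx` and the Sobolev space -/

/-- The multiplier `(1 + 2πiξ)^{-γ}` as a superposition of translations. -/
theorem integral_fourier_multiplier {γ : ℝ} (hγ : 0 < γ) {f h : Lp ℂ 2 (volume : Measure ℝ)}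
    (hf : (𝓕 f : Lp ℂ 2 (volume : Measure ℝ)) =ᵐ[volume]
      fun ξ => (1 + freq ξ) ^ (-γ : ℂ) * (𝓕 h : Lp ℂ 2 (volume : Measure ℝ)) ξ)
    {κ : ℝ → ℂ} (hκ : MemLp κ 2) :
    (∫ ξ, (𝓕 f : Lp ℂ 2 (volume : Measure ℝ)) ξ * κ ξ) * (Real.Gamma γ : ℂ)
      = ∫ s in Ioi (0 : ℝ), ((s ^ (γ - 1) : ℝ) : ℂ) * Complex.exp (-1 * s) *
          ∫ ξ, (𝓕 h : Lp ℂ 2 (volume : Measure ℝ)) ξ * (Complex.exp (-freq ξ * s) * κ ξ) := by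
  have hi : Integrable (fun ξ => (𝓕 h : Lp ℂ 2 (volume : Measure ℝ)) ξ * κ ξ) :=
    MemLp.integrable_mul (Lp.memLp _) hκ
  have hk : IntegrableOn (fun s : ℝ => ((s ^ (γ - 1) : ℝ) : ℂ) * Complex.exp (-1 * s)) (Ioi 0) :=
    integrableOn_rpow_mul_cexp (by linarith) (by simp)
  have hprod := hi.mul_prod hk
  have hprod' : Integrable (fun p : ℝ × ℝ => Complex.exp (-freq p.1 * p.2) *
      (((𝓕 h : Lp ℂ 2 (volume : Measure ℝ)) p.1 * κ p.1) *
        (((p.2 ^ (γ - 1) : ℝ) : ℂ) * Complex.exp (-1 * p.2))))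
      (volume.prod (volume.restrict (Ioi 0))) := by
    refine hprod.bdd_mul (c := 1) (Continuous.aestronglyMeasurable ?_)
      (Eventually.of_forall fun p => ?_)
    · unfold freq; fun_prop
    · simp [Complex.norm_exp, freq_re]
  calc _ = ∫ ξ, ∫ s in Ioi (0 : ℝ), Complex.exp (-freq ξ * s) *
      (((𝓕 h : Lp ℂ 2 (volume : Measure ℝ)) ξ * κ ξ) *
        (((s ^ (γ - 1) : ℝ) : ℂ) * Complex.exp (-1 * s))) := by
        rw [← integral_mul_const]
        refine integral_congr_ae ?_
        filter_upwards [hf] with ξ hξ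
        -- Each `e^{-freq ξ s}` with `s > 0` is a delay by `s`. The weight `s^{γ-1} e^{-s}` is
        -- integrable and the delays are unimodular, so Fubini applies.
        have e := integral_rpow_mul_cexp hγ (r := 1 + freq ξ) (by simp [freq_re])
        rw [hξ]
        calc _ = ((𝓕 h : Lp ℂ 2 (volume : Measure ℝ)) ξ * κ ξ) *
            ((1 + freq ξ) ^ (-γ : ℂ) * (Real.Gamma γ : ℂ)) := by ring
          _ = _ := by
            rw [← e, ← integral_const_mul]
            congr 1; funext s
            have : Complex.exp (-(1 + freq ξ) * s)
                = Complex.exp (-freq ξ * s) * Complex.exp (-1 * s) := by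
              rw [← Complex.exp_add]; ring_nf
            rw [this]; ring
    _ = ∫ s in Ioi (0 : ℝ), ∫ ξ, Complex.exp (-freq ξ * s) *
      (((𝓕 h : Lp ℂ 2 (volume : Measure ℝ)) ξ * κ ξ) *
        (((s ^ (γ - 1) : ℝ) : ℂ) * Complex.exp (-1 * s))) := integral_integral_swap hprod'
    _ = _ := by
      congr 1; funext s
      rw [← integral_const_mul]
      congr 1; funext ξ
      ring

theorem gamma_ofReal_ne_zero {γ : ℝ} (hγ : 0 < γ) : (Real.Gamma γ : ℂ) ≠ 0 :=
  Complex.ofReal_ne_zero.2 (Real.Gamma_pos_of_pos hγ).ne'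

/-- The multiplier averages delays by `s > 0`, and a delay of a causal function still pairs to zero
with every `e^{wt}` on `t ≤ 0`. -/
theorem IsCausal.of_multiplier {γ : ℝ} (hγ : 0 < γ) {f h : Lp ℂ 2 (volume : Measure ℝ)}
    (hh : IsCausal h) (hf : (𝓕 f : Lp ℂ 2 (volume : Measure ℝ)) =ᵐ[volume]
      fun ξ => (1 + freq ξ) ^ (-γ : ℂ) * (𝓕 h : Lp ℂ 2 (volume : Measure ℝ)) ξ) :
    IsCausal f := by
  refine isCausal_of_forall fun w hw => ?_
  rw [← integral_fourier_mul_inv_add hw]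
  have h1 := integral_fourier_multiplier hγ hf (memLp_inv_add_freq hw)
  refine (mul_eq_zero.1 (h1.trans ?_)).resolve_right (gamma_ofReal_ne_zero hγ)
  rw [setIntegral_congr_fun (g := fun _ => (0 : ℂ)) measurableSet_Ioi, integral_zero]
  intro s hs
  have h2 := integral_fourier_div_add hw s h
  rw [hh.setIntegral_Iic (by simpa using le_of_lt (mem_Ioi.1 hs))] at h2
  simp only [div_eq_mul_inv] at h2
  simp only [h2, mul_zero]

theorem IsCausal.setIntegral_Ioi {u : Lp ℂ 2 (volume : Measure ℝ)} (hu : IsCausal u)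
    {c : ℝ} (hc : c ≤ 0) (κ : ℝ → ℂ) :
    ∫ t in Ioi c, u t * κ t = ∫ t in Ioi (0 : ℝ), u t * κ t := by
  rw [← integral_indicator measurableSet_Ioi, ← integral_indicator measurableSet_Ioi]
  refine integral_congr_ae ?_
  filter_upwards [hu, Measure.ae_ne volume (0 : ℝ)] with t ht h0
  rcases lt_or_gt_of_ne h0 with h | h
  · simp [indicator, ht h]
  · rw [indicator_of_mem (mem_Ioi.2 h), indicator_of_mem (mem_Ioi.2 (lt_of_le_of_lt hc h))]

theorem IsCausal.laplace_multiplier {γ : ℝ} (hγ : 0 < γ) {f h : Lp ℂ 2 (volume : Measure ℝ)}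
    (hh : IsCausal h) (hf : (𝓕 f : Lp ℂ 2 (volume : Measure ℝ)) =ᵐ[volume]
      fun ξ => (1 + freq ξ) ^ (-γ : ℂ) * (𝓕 h : Lp ℂ 2 (volume : Measure ℝ)) ξ)
    {z : ℂ} (hz : 0 < z.re) :
    laplace f z = (1 + z) ^ (-γ : ℂ) * laplace h z := by
  have h1 := integral_fourier_multiplier hγ hf (memLp_inv_sub_freq hz)
  rw [integral_fourier_mul_inv_sub hz] at h1
  refine mul_right_cancel₀ (gamma_ofReal_ne_zero hγ) (h1.trans ?_)
  rw [mul_right_comm, ← integral_rpow_mul_cexp hγ (r := 1 + z) (by simp; linarith),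
    ← integral_mul_const]
  refine setIntegral_congr_fun measurableSet_Ioi fun s hs => ?_
  have h2 := integral_fourier_div_sub hz s h
  rw [hh.setIntegral_Ioi (by simpa using le_of_lt (mem_Ioi.1 hs))] at h2
  have h3 : ∫ t in Ioi (0 : ℝ), h t * Complex.exp (-z * (t + s))
      = Complex.exp (-z * s) * laplace h z := by
    rw [laplace, ← integral_const_mul]
    congr 1; funext t
    rw [mul_left_comm, ← Complex.exp_add]; ring_nf
  simp only [div_eq_mul_inv] at h2
  simp only [h2, h3]
  have : Complex.exp (-(1 + z) * s) = Complex.exp (-1 * s) * Complex.exp (-z * s) := by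
    rw [← Complex.exp_add]; ring_nf
  rw [this]; ring

theorem tendsto_integral_mul_exp_Iic (h : Lp ℂ 2 (volume : Measure ℝ)) :
    Tendsto (fun n : ℕ => ∫ t in Iic (0 : ℝ), h t * Complex.exp (((n + 1 : ℕ) : ℂ) * t))
      atTop (𝓝 0) := by
  have hb := (integrableOn_mul_exp_Iic (w := 1) (by simp) h).norm
  have := tendsto_integral_of_dominated_convergence (μ := volume.restrict (Iic (0 : ℝ)))
    (F := fun (n : ℕ) t => h t * Complex.exp (((n + 1 : ℕ) : ℂ) * t)) (f := fun _ => 0) _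
    (fun n => ?_) hb (fun n => ?_) ?_
  · simpa using this
  · exact (integrableOn_mul_exp_Iic (by simp; positivity) h).aestronglyMeasurable
  · filter_upwards [ae_restrict_mem measurableSet_Iic] with t ht
    rw [norm_mul, norm_mul]
    have ht : t ≤ 0 := ht
    gcongr
    simp only [Complex.norm_exp]
    apply Real.exp_le_exp.2
    simp only [Complex.mul_re, Complex.natCast_re, Complex.ofReal_re, Complex.ofReal_im, mul_zero,
      sub_zero, Complex.one_re]
    push_cast
    nlinarith [Nat.cast_nonneg (α := ℝ) n]
  · filter_upwards [ae_restrict_mem measurableSet_Iic,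
      ae_restrict_of_ae (Measure.ae_ne volume (0 : ℝ))] with t ht h0
    have ht : t < 0 := lt_of_le_of_ne ht h0
    rw [show (0 : ℂ) = h t * 0 by simp]
    refine tendsto_const_nhds.mul ?_
    have e : ∀ n : ℕ, Complex.exp (((n + 1 : ℕ) : ℂ) * t) = Complex.exp t ^ (n + 1) := fun n => by
      rw [← Complex.exp_nat_mul]
    simp only [e]
    refine (tendsto_pow_atTop_nhds_zero_of_norm_lt_one ?_).comp (tendsto_add_atTop_nat 1)
    simpa [Complex.norm_exp] using ht

/-- The resolvent identity for `1/((1+s)(w+s))` turns causality of `f` into the statement that `∫_{t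
≤ 0} h(t) e^{wt} dt` does not depend on `w`. It tends to zero as `w → ∞` through the integers, so it
vanishes for all `w`. -/
theorem IsCausal.of_inv_multiplier {f h : Lp ℂ 2 (volume : Measure ℝ)} (hc : IsCausal f)
    (hf : (𝓕 f : Lp ℂ 2 (volume : Measure ℝ)) =ᵐ[volume]
      fun ξ => (1 + freq ξ)⁻¹ * (𝓕 h : Lp ℂ 2 (volume : Measure ℝ)) ξ) :
    IsCausal h := by
  have hinterp : ∀ w : ℂ, 0 < w.re →
      Integrable (fun ξ => (𝓕 h : Lp ℂ 2 (volume : Measure ℝ)) ξ * (w + freq ξ)⁻¹) :=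
    fun w hw => MemLp.integrable_mul (Lp.memLp _) (memLp_inv_add_freq hw)
  have key : ∀ w : ℂ, 0 < w.re →
      ∫ t in Iic (0 : ℝ), h t * Complex.exp (w * t)
        = ∫ t in Iic (0 : ℝ), h t * Complex.exp ((1 : ℂ) * t) := by
    intro w hw
    by_cases h1 : w = 1
    · rw [h1]
    rw [← integral_fourier_mul_inv_add hw, ← integral_fourier_mul_inv_add (by simp)]
    have h2 := integral_fourier_mul_inv_add hw f
    rw [hc.setIntegral_Iic le_rfl] at h2
    have h3 : ∫ ξ, (𝓕 f : Lp ℂ 2 (volume : Measure ℝ)) ξ * (w + freq ξ)⁻¹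
        = (w - 1)⁻¹ * ∫ ξ, ((𝓕 h : Lp ℂ 2 (volume : Measure ℝ)) ξ * (1 + freq ξ)⁻¹ -
            (𝓕 h : Lp ℂ 2 (volume : Measure ℝ)) ξ * (w + freq ξ)⁻¹) := by
      rw [← integral_const_mul]
      refine integral_congr_ae ?_
      filter_upwards [hf] with ξ hξ
      rw [hξ]
      have a1 := add_freq_ne_zero (z := 1) (by simp) ξ
      have a2 := add_freq_ne_zero hw ξ
      have a3 : w - 1 ≠ 0 := sub_ne_zero.2 h1
      field_simp
      ring
    rw [h3, integral_sub (hinterp 1 (by simp)) (hinterp w hw)] at h2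
    have := (mul_eq_zero.1 h2).resolve_left (inv_ne_zero (sub_ne_zero.2 h1))
    exact (sub_eq_zero.1 this).symm
  have h0 : ∫ t in Iic (0 : ℝ), h t * Complex.exp ((1 : ℂ) * t) = 0 := by
    refine tendsto_nhds_unique (tendsto_const_nhds.congr fun n => ?_)
      (tendsto_integral_mul_exp_Iic h)
    exact (key _ (by simp; positivity)).symm
  exact isCausal_of_forall fun w hw => (key w hw).trans h0

theorem measurable_freq : Measurable freq := by unfold freq; fun_prop

theorem one_le_norm_one_add_freq (ξ : ℝ) : 1 ≤ ‖1 + freq ξ‖ := by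
  have := Complex.abs_re_le_norm (1 + freq ξ)
  simpa [freq_re] using this

theorem IsCausal.of_inv_pow_multiplier (n : ℕ) {f h : Lp ℂ 2 (volume : Measure ℝ)}
    (hc : IsCausal f) (hf : (𝓕 f : Lp ℂ 2 (volume : Measure ℝ)) =ᵐ[volume]
      fun ξ => (1 + freq ξ)⁻¹ ^ n * (𝓕 h : Lp ℂ 2 (volume : Measure ℝ)) ξ) :
    IsCausal h := by
  induction n generalizing h with
  | zero =>
    have : (𝓕 f : Lp ℂ 2 (volume : Measure ℝ)) = 𝓕 h := Lp.ext (by simpa using hf)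
    have := (Lp.fourierTransformₗᵢ ℝ ℂ).injective this
    rwa [← this]
  | succ n ih =>
    obtain ⟨k, hk⟩ := exists_fourier_ae_eq_mul (m := fun ξ => (1 + freq ξ)⁻¹) (C := 1)
      ((measurable_const.add measurable_freq).inv) (fun ξ => by
        rw [norm_inv]; exact inv_le_one_of_one_le₀ (one_le_norm_one_add_freq ξ)) h
    refine (ih (h := k) ?_).of_inv_multiplier hk
    filter_upwards [hf, hk] with ξ h1 h2
    rw [h1, h2]; ring

theorem measurable_one_add_freq_cpow (a : ℂ) : Measurable fun ξ => (1 + freq ξ) ^ a :=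
  (measurable_const.add measurable_freq).pow_const a

theorem one_add_freq_ne_zero (ξ : ℝ) : 1 + freq ξ ≠ 0 := add_freq_ne_zero (by simp) ξ

theorem norm_one_add_freq_cpow (a : ℝ) (ξ : ℝ) :
    ‖(1 + freq ξ) ^ (a : ℂ)‖ = ‖1 + freq ξ‖ ^ a := Complex.norm_cpow_real _ _

/-- A fractional power cannot be undone by the resolvent identity, so `f` is smoothed further, by
the order `n - β`, until the total exponent is the integer `n`. Smoothing keeps causality, and the
`n` integer factors are then removed one at a time. -/
theorem IsCausal.of_cpow_multiplier {β : ℝ} (f h : Lp ℂ 2 (volume : Measure ℝ))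
    (hc : IsCausal f) (hf : (𝓕 f : Lp ℂ 2 (volume : Measure ℝ)) =ᵐ[volume]
      fun ξ => (1 + freq ξ) ^ (-β : ℂ) * (𝓕 h : Lp ℂ 2 (volume : Measure ℝ)) ξ) :
    IsCausal h := by
  obtain ⟨n, hn⟩ := exists_nat_gt β
  have hγ : 0 < (n : ℝ) - β := by linarith
  obtain ⟨k, hk⟩ := exists_fourier_ae_eq_mul
    (m := fun ξ => (1 + freq ξ) ^ (-((n - β : ℝ) : ℂ))) (C := 1)
    (measurable_one_add_freq_cpow _) (fun ξ => by
      rw [← Complex.ofReal_neg, norm_one_add_freq_cpow]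
      exact Real.rpow_le_one_of_one_le_of_nonpos (one_le_norm_one_add_freq ξ) (by linarith)) f
  refine (hc.of_multiplier hγ hk).of_inv_pow_multiplier n ?_
  filter_upwards [hf, hk] with ξ h1 h2
  rw [h2, h1, ← mul_assoc, ← Complex.cpow_add _ _ (one_add_freq_ne_zero ξ)]
  have : (-((n - β : ℝ) : ℂ) + -β) = -(n : ℂ) := by push_cast; ring
  rw [this, Complex.cpow_neg, Complex.cpow_natCast, inv_pow]

theorem exists_isCausal_laplace_of_mem_sobolev {β : ℝ} (hβ : 0 < β)
    {f : Lp ℂ 2 (volume : Measure ℝ)} (hf : f ∈ sobolevHalfLine β) :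
    ∃ h : Lp ℂ 2 (volume : Measure ℝ), IsCausal h ∧
      ∀ z : ℂ, 0 < z.re → laplace f z = (1 + z) ^ (-β : ℂ) * laplace h z := by
  obtain ⟨hc, g, hg⟩ := hf
  -- The inhomogeneous symbol is controlled by the given one through `|1+s|^β ≤ 2^β (1 + |s|^β)`.
  have hm : MemLp (fun ξ => (1 + freq ξ) ^ (β : ℂ) * (𝓕 f : Lp ℂ 2 (volume : Measure ℝ)) ξ) 2 := by
    refine MemLp.of_le_mul (c := 2 ^ β)
      ((Lp.memLp (𝓕 f : Lp ℂ 2 (volume : Measure ℝ))).norm.add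
        (Lp.memLp (𝓕 g : Lp ℂ 2 (volume : Measure ℝ))).norm) ?_ ?_
    · exact (measurable_one_add_freq_cpow _).aestronglyMeasurable.mul
        (Lp.memLp _).aestronglyMeasurable
    · filter_upwards [hg] with ξ hξ
      rw [norm_mul, norm_one_add_freq_cpow]
      simp only [Pi.add_apply, Real.norm_eq_abs]
      rw [abs_of_nonneg (by positivity), hξ, norm_mul, Complex.norm_cpow_real]
      change _ ≤ 2 ^ β * (_ + ‖freq ξ‖ ^ β * _)
      set a := ‖freq ξ‖
      have ha : 0 ≤ a := norm_nonneg _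
      have h1 : ‖1 + freq ξ‖ ≤ 1 + a := (norm_add_le _ _).trans (by simp [a])
      have h2 : ‖1 + freq ξ‖ ^ β ≤ 2 ^ β * (1 + a ^ β) := by
        calc _ ≤ (1 + a) ^ β := by gcongr
          _ ≤ (2 * max 1 a) ^ β := by
            gcongr
            linarith [le_max_left 1 a, le_max_right 1 a]
          _ = 2 ^ β * (max 1 a) ^ β := Real.mul_rpow (by norm_num) (by positivity)
          _ ≤ _ := by
            gcongr
            rcases le_total 1 a with h | h
            · rw [max_eq_right h]; linarith
            · rw [max_eq_left h, Real.one_rpow]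
              have := Real.rpow_nonneg ha β
              linarith
      calc _ ≤ 2 ^ β * (1 + a ^ β) * ‖(𝓕 f : Lp ℂ 2 (volume : Measure ℝ)) ξ‖ := by gcongr
        _ = _ := by ring
  obtain ⟨h, hh⟩ := exists_fourier_ae_eq hm
  have hf' : (𝓕 f : Lp ℂ 2 (volume : Measure ℝ)) =ᵐ[volume]
      fun ξ => (1 + freq ξ) ^ (-β : ℂ) * (𝓕 h : Lp ℂ 2 (volume : Measure ℝ)) ξ := by
    filter_upwards [hh] with ξ hξ
    rw [hξ, ← mul_assoc, ← Complex.cpow_add _ _ (one_add_freq_ne_zero ξ)]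
    simp
  have hhc := IsCausal.of_cpow_multiplier f h hc hf'
  exact ⟨h, hhc, fun z hz => hhc.laplace_multiplier hβ hf' hz⟩

theorem exists_mem_sobolev_laplace {β : ℝ} (hβ : 0 < β)
    {h : Lp ℂ 2 (volume : Measure ℝ)} (hh : IsCausal h) :
    ∃ f ∈ sobolevHalfLine β,
      ∀ z : ℂ, 0 < z.re → laplace f z = (1 + z) ^ (-β : ℂ) * laplace h z := by
  obtain ⟨f, hf⟩ := exists_fourier_ae_eq_mul
    (m := fun ξ => (1 + freq ξ) ^ (-β : ℂ)) (C := 1)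
    (measurable_one_add_freq_cpow _) (fun ξ => by
      rw [← Complex.ofReal_neg, norm_one_add_freq_cpow]
      exact Real.rpow_le_one_of_one_le_of_nonpos (one_le_norm_one_add_freq ξ) (by linarith)) h
  -- The derivative of `f` is `h` multiplied by `(s/(1+s))^β` in modulus, bounded by `1` because
  -- `|s| ≤ |1+s|` on the imaginary axis.
  obtain ⟨g, hg⟩ := exists_fourier_ae_eq_mul
    (m := fun ξ => freq ξ ^ (β : ℂ) * (1 + freq ξ) ^ (-β : ℂ)) (C := 1)
    ((measurable_freq.pow_const _).mul (measurable_one_add_freq_cpow _)) (fun ξ => by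
      rw [← Complex.ofReal_neg, norm_mul, norm_one_add_freq_cpow, Complex.norm_cpow_real,
        Real.rpow_neg (norm_nonneg _)]
      have h1 := one_le_norm_one_add_freq ξ
      have h2 : ‖freq ξ‖ ≤ ‖1 + freq ξ‖ := by
        rw [← sq_le_sq₀ (norm_nonneg _) (norm_nonneg _), ← Complex.normSq_eq_norm_sq,
          ← Complex.normSq_eq_norm_sq, Complex.normSq_apply, Complex.normSq_apply]
        simp [freq_re]
      have h3 : 0 < ‖1 + freq ξ‖ ^ β := Real.rpow_pos_of_pos (by linarith) _
      rw [← div_eq_mul_inv, div_le_one h3]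
      gcongr) h
  refine ⟨f, ⟨hh.of_multiplier hβ hf, g, ?_⟩, fun z hz => hh.laplace_multiplier hβ hf hz⟩
  unfold IsFractionalDeriv
  filter_upwards [hf, hg] with ξ h1 h2
  rw [h1, h2, mul_assoc]; rfl

/-! ### Cauchy kernels as reproducing kernels -/

/-- The Cauchy kernel as an element of `L²`: the class of `e^{-zt}` on `t > 0`. -/
def cauchyKernel (z : ℂ) : Lp ℂ 2 (volume : Measure ℝ) :=
  if h : 0 < z.re then (memLp_decayExp h 0).toLp _ else 0

/-- The anticausal Cauchy kernel: the class of `e^{wt}` on `t ≤ 0`. -/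
def anticausalKernel (w : ℂ) : Lp ℂ 2 (volume : Measure ℝ) :=
  if h : 0 < w.re then (memLp_growExp h 0).toLp _ else 0

theorem conj_re_pos {z : ℂ} (hz : 0 < z.re) : 0 < (conj z).re := by simpa using hz

theorem coeFn_cauchyKernel {z : ℂ} (hz : 0 < z.re) :
    cauchyKernel z =ᵐ[volume] decayExp z 0 := by
  rw [cauchyKernel, dif_pos hz]; exact MemLp.coeFn_toLp _

theorem coeFn_anticausalKernel {w : ℂ} (hw : 0 < w.re) :
    anticausalKernel w =ᵐ[volume] growExp w 0 := by
  rw [anticausalKernel, dif_pos hw]; exact MemLp.coeFn_toLp _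

theorem fourier_cauchyKernel {z : ℂ} (hz : 0 < z.re) :
    (𝓕 (cauchyKernel z) : Lp ℂ 2 (volume : Measure ℝ)) =ᵐ[volume] fun ξ => (z + freq ξ)⁻¹ := by
  rw [cauchyKernel, dif_pos hz]
  filter_upwards [fourier_toLp_ae_eq (integrable_decayExp hz 0) (memLp_decayExp hz 0)] with ξ hξ
  rw [hξ, fourier_decayExp hz]; simp

theorem fourier_anticausalKernel {w : ℂ} (hw : 0 < w.re) :
    (𝓕 (anticausalKernel w) : Lp ℂ 2 (volume : Measure ℝ)) =ᵐ[volume]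
      fun ξ => (w - freq ξ)⁻¹ := by
  rw [anticausalKernel, dif_pos hw]
  filter_upwards [fourier_toLp_ae_eq (integrable_growExp hw 0) (memLp_growExp hw 0)] with ξ hξ
  rw [hξ, fourier_growExp hw]; simp

theorem inner_cauchyKernel {z : ℂ} (hz : 0 < z.re) (u : Lp ℂ 2 (volume : Measure ℝ)) :
    inner ℂ (cauchyKernel (conj z)) u = laplace u z := by
  rw [L2.inner_def, laplace, ← integral_indicator measurableSet_Ioi]
  refine integral_congr_ae ?_
  filter_upwards [coeFn_cauchyKernel (conj_re_pos hz)] with t ht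
  rw [ht, RCLike.inner_apply]
  by_cases h : t ∈ Ioi (0 : ℝ)
  · have h' : 0 < t := h
    simp [decayExp, h', ← Complex.exp_conj]
  · have h' : ¬ 0 < t := h
    simp [decayExp, h']

theorem IsCausal.inner_anticausalKernel {w : ℂ} (hw : 0 < w.re)
    {u : Lp ℂ 2 (volume : Measure ℝ)} (hu : IsCausal u) :
    inner ℂ (anticausalKernel w) u = 0 := by
  rw [L2.inner_def, ← hu.setIntegral_Iic le_rfl (fun t => conj (Complex.exp (w * t))),
    ← integral_indicator measurableSet_Iic]
  refine integral_congr_ae ?_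
  filter_upwards [coeFn_anticausalKernel hw] with t ht
  rw [ht, RCLike.inner_apply]
  by_cases h : t ∈ Iic (0 : ℝ)
  · have h' : t ≤ 0 := h
    simp [growExp, h']
  · have h' : ¬ t ≤ 0 := h
    simp [growExp, h']

theorem laplace_cauchyKernel {a z : ℂ} (ha : 0 < a.re) (hz : 0 < z.re) :
    laplace (cauchyKernel a) z = (z + a)⁻¹ := by
  have h := integral_exp_mul_complex_Ioi (a := -(z + a)) (by simp; linarith) 0
  simp only [Complex.ofReal_zero, mul_zero, Complex.exp_zero, neg_div_neg_eq, one_div] at h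
  rw [laplace, ← h, ← integral_indicator measurableSet_Ioi, ← integral_indicator measurableSet_Ioi]
  refine integral_congr_ae ?_
  filter_upwards [coeFn_cauchyKernel ha] with t ht
  by_cases h : t ∈ Ioi (0 : ℝ)
  · have h' : 0 < t := h
    simp only [ht, decayExp, indicator_of_mem h, neg_zero, Complex.ofReal_zero, add_zero,
      ← Complex.exp_add]
    ring_nf
  · simp [indicator_of_notMem h]

theorem inner_cauchyKernel_cauchyKernel {a b : ℂ} (ha : 0 < a.re) (hb : 0 < b.re) :
    inner ℂ (cauchyKernel a) (cauchyKernel b) = (conj a + b)⁻¹ := by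
  have := inner_cauchyKernel (conj_re_pos ha) (cauchyKernel b)
  rw [Complex.conj_conj] at this
  rw [this, laplace_cauchyKernel hb (conj_re_pos ha)]

theorem norm_cauchyKernel_sq {a : ℂ} (ha : 0 < a.re) :
    ‖cauchyKernel a‖ ^ 2 = (2 * a.re)⁻¹ := by
  have h := inner_self_eq_norm_sq_to_K (𝕜 := ℂ) (cauchyKernel a)
  rw [inner_cauchyKernel_cauchyKernel ha ha, add_comm, Complex.add_conj] at h
  have h2 : (((2 * a.re)⁻¹ : ℝ) : ℂ) = ((‖cauchyKernel a‖ ^ 2 : ℝ) : ℂ) := by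
    simpa using h
  exact (Complex.ofReal_injective h2).symm

theorem norm_le_norm_of_fourier {u v : Lp ℂ 2 (volume : Measure ℝ)}
    (h : ∀ᵐ ξ : ℝ, ‖(𝓕 u : Lp ℂ 2 (volume : Measure ℝ)) ξ‖
      ≤ ‖(𝓕 v : Lp ℂ 2 (volume : Measure ℝ)) ξ‖) : ‖u‖ ≤ ‖v‖ := by
  rw [← Lp.norm_fourier_eq u, ← Lp.norm_fourier_eq v]
  exact Lp.norm_le_norm_of_ae_le h

theorem fourier_sum_cauchyKernel {ι : Type*} (S : Finset ι) (a z : ι → ℂ)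
    (hz : ∀ k ∈ S, 0 < (z k).re) :
    (𝓕 (∑ k ∈ S, a k • cauchyKernel (z k)) : Lp ℂ 2 (volume : Measure ℝ)) =ᵐ[volume]
      fun ξ => ∑ k ∈ S, a k * (z k + freq ξ)⁻¹ := by
  have e : (𝓕 (∑ k ∈ S, a k • cauchyKernel (z k)) : Lp ℂ 2 (volume : Measure ℝ))
      = ∑ k ∈ S, a k • (𝓕 (cauchyKernel (z k)) : Lp ℂ 2 (volume : Measure ℝ)) := by
    change Lp.fourierTransformₗᵢ ℝ ℂ _ = ∑ k ∈ S, a k • Lp.fourierTransformₗᵢ ℝ ℂ _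
    simp only [map_sum, map_smul]
  rw [e]
  have h1 := Lp.coeFn_finsetSum S
    (fun k => a k • (𝓕 (cauchyKernel (z k)) : Lp ℂ 2 (volume : Measure ℝ)))
  have h2 : ∀ᵐ ξ : ℝ, ∀ k ∈ S,
      (a k • (𝓕 (cauchyKernel (z k)) : Lp ℂ 2 (volume : Measure ℝ)) : Lp ℂ 2 volume) ξ
        = a k * (z k + freq ξ)⁻¹ := by
    rw [Filter.eventually_all_finset]
    intro k hk
    filter_upwards [Lp.coeFn_smul (a k) (𝓕 (cauchyKernel (z k)) : Lp ℂ 2 (volume : Measure ℝ)),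
      fourier_cauchyKernel (hz k hk)] with ξ h3 h4
    rw [h3, Pi.smul_apply, h4, smul_eq_mul]
  filter_upwards [h1, h2] with ξ h3 h4
  rw [h3]
  simp only [Finset.sum_apply]
  exact Finset.sum_congr rfl h4

/-! ### Finite Blaschke products, interpolants and residues -/

/-- Lagrange interpolation at the poles reproduces `P` because its degree is below the number of
nodes; dividing by the nodal polynomial gives the expansion. -/
theorem partial_fractions {κ : Type*} [DecidableEq κ] (S : Finset κ) (v : κ → ℂ)
    (hv : Set.InjOn v S) (P : Polynomial ℂ) (hP : P.degree < S.card) (s : ℂ)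
    (hs : ∀ j ∈ S, s ≠ v j) :
    P.eval s / ∏ j ∈ S, (s - v j)
      = ∑ j ∈ S, P.eval (v j) / (∏ i ∈ S.erase j, (v j - v i)) / (s - v j) := by
  have h0 : ∏ j ∈ S, (s - v j) ≠ 0 :=
    Finset.prod_ne_zero_iff.2 fun j hj => sub_ne_zero.2 (hs j hj)
  rw [div_eq_iff h0]
  conv_lhs => rw [Lagrange.eq_interpolate hv hP]
  rw [Lagrange.eval_interpolate_not_at_node _ hs, Lagrange.eval_nodal, mul_comm]
  congr 1
  refine Finset.sum_congr rfl fun j _ => ?_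
  rw [Lagrange.nodalWeight, Finset.prod_inv_distrib]
  field_simp

/-- The product `∏_{j ∈ S, j ≠ k} p(z_j, z_k)`. -/
def finiteBlaschke {ι : Type*} [DecidableEq ι] (z : ι → ℂ) (S : Finset ι) (k : ι) : ℝ :=
  ∏ j ∈ S.erase k, pseudoHyperbolic (z j) (z k)

theorem add_conj_ne_zero {a b : ℂ} (ha : 0 < a.re) (hb : 0 < b.re) : a + conj b ≠ 0 := fun h => by
  have := congrArg Complex.re h
  simp at this
  linarith

theorem norm_add_conj_comm (a b : ℂ) : ‖a + conj b‖ = ‖b + conj a‖ := by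
  rw [← Complex.norm_conj, map_add, Complex.conj_conj, add_comm]

theorem norm_add_conj_self {a : ℂ} (ha : 0 < a.re) : ‖a + conj a‖ = 2 * a.re := by
  rw [Complex.add_conj, Complex.norm_real, Real.norm_eq_abs, abs_of_pos (by linarith)]

/-- This is the unimodularity of the Blaschke factor `(s - z)/(s + conj z)` on the imaginary axis,
where conjugation is `s ↦ -s`. -/
theorem norm_freq_add_conj (ξ : ℝ) (z : ℂ) : ‖freq ξ + conj z‖ = ‖freq ξ - z‖ := by
  rw [← Complex.norm_conj, map_add, Complex.conj_conj, conj_freq, ← norm_neg]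
  congr 1; ring

theorem finiteBlaschke_pos {ι : Type*} [DecidableEq ι] {z : ι → ℂ} {S : Finset ι}
    (hz : ∀ k ∈ S, 0 < (z k).re) (hinj : Set.InjOn z S) {k : ι} (hk : k ∈ S) :
    0 < finiteBlaschke z S k := by
  refine Finset.prod_pos fun j hj => ?_
  obtain ⟨h1, h2⟩ := Finset.mem_erase.1 hj
  refine norm_pos_iff.2 (div_ne_zero (sub_ne_zero.2 fun h => h1 (hinj h2 hk h)) ?_)
  exact add_conj_ne_zero (hz j h2) (hz k hk)

theorem finiteBlaschke_eq {ι : Type*} [DecidableEq ι] (z : ι → ℂ) (S : Finset ι) (k : ι) :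
    finiteBlaschke z S k
      = (∏ j ∈ S.erase k, ‖z k - z j‖) / ∏ j ∈ S.erase k, ‖z k + conj (z j)‖ := by
  rw [finiteBlaschke, ← Finset.prod_div_distrib]
  refine Finset.prod_congr rfl fun j _ => ?_
  rw [pseudoHyperbolic, norm_div, norm_sub_rev, norm_add_conj_comm]

/-- Interpolation at finitely many points, with the minimal norm expressed through the residues
of the reciprocal of the Blaschke product. -/
theorem exists_finite_interpolant {ι : Type*} [DecidableEq ι] (S : Finset ι) (z : ι → ℂ)
    (hz : ∀ k ∈ S, 0 < (z k).re) (hinj : Set.InjOn z S) (τ : ι → ℂ) :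
    ∃ c : ι → ℂ, (∀ k ∈ S, ‖c k‖ = ‖τ k‖ * (2 * (z k).re) / finiteBlaschke z S k) ∧
      ∃ F : Lp ℂ 2 (volume : Measure ℝ), (∀ k ∈ S, laplace F (z k) = τ k) ∧
        ‖F‖ ≤ ‖∑ k ∈ S, c k • cauchyKernel (conj (z k))‖ := by
  let N : ι → ℂ := fun k => ∏ j ∈ S.erase k, (z k - z j)
  let D : ι → ℂ := fun k => ∏ j ∈ S, (z k + conj (z j))
  have hN : ∀ k ∈ S, N k ≠ 0 := fun k hk => Finset.prod_ne_zero_iff.2 fun j hj => by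
    obtain ⟨h1, h2⟩ := Finset.mem_erase.1 hj
    exact sub_ne_zero.2 fun h => h1 (hinj h2 hk h.symm)
  have hD : ∀ k ∈ S, D k ≠ 0 := fun k hk => Finset.prod_ne_zero_iff.2 fun j hj =>
    add_conj_ne_zero (hz k hk) (hz j hj)
  -- With `B_S(s) = ∏ (s - z_j)/(s + conj z_j)`, the interpolant is `B_S(s) ∑ c_k/(s - z_k)`. At
  -- `z_k` only one term survives, with value `c_k N_k / D_k`, which forces this choice. `P` below
  -- is its numerator over `∏ (s + conj z_j)`, so its poles all lie in the left half-plane.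
  let c : ι → ℂ := fun k => τ k * D k / N k
  let v : ι → ℂ := fun j => -conj (z j)
  have hv : Set.InjOn v S := fun i hi j hj h =>
    hinj hi hj ((starRingEnd ℂ).injective (neg_injective h))
  let P : Polynomial ℂ :=
    ∑ k ∈ S, Polynomial.C (c k) * ∏ j ∈ S.erase k, (Polynomial.X - Polynomial.C (z j))
  have hPe : ∀ s, P.eval s = ∑ k ∈ S, c k * ∏ j ∈ S.erase k, (s - z j) := fun s => by
    simp [P, Polynomial.eval_finsetSum, Polynomial.eval_prod]
  have hPd : P.degree < S.card := by
    refine (Polynomial.degree_sum_le _ _).trans_lt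
      ((Finset.sup_lt_iff (WithBot.bot_lt_coe S.card)).2 fun k hk => ?_)
    have h1 : (∏ j ∈ S.erase k, (Polynomial.X - Polynomial.C (z j))).degree
        = ((S.erase k).card : WithBot ℕ) := by
      rw [← Lagrange.nodal_eq, Lagrange.degree_nodal]
    have h2 : ((S.erase k).card : WithBot ℕ) < (S.card : WithBot ℕ) := by
      exact_mod_cast Finset.card_erase_lt_of_mem hk
    refine lt_of_le_of_lt ?_ h2
    rw [Polynomial.degree_mul, h1]
    exact (add_le_add_left Polynomial.degree_C_le _).trans (zero_add _).le
  let d : ι → ℂ := fun j => P.eval (v j) / (∏ i ∈ S.erase j, (v j - v i))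
  have hpf : ∀ s : ℂ, (∀ j ∈ S, s + conj (z j) ≠ 0) →
      P.eval s / ∏ j ∈ S, (s + conj (z j)) = ∑ j ∈ S, d j * (conj (z j) + s)⁻¹ := by
    intro s hs
    have h := partial_fractions S v hv P hPd s (fun j hj h => hs j hj (by simp [h, v]))
    simpa [v, d, div_eq_mul_inv, add_comm] using h
  refine ⟨fun k => conj (c k), fun k hk => ?_, ∑ j ∈ S, d j • cauchyKernel (conj (z j)),
    fun k hk => ?_, ?_⟩
  · have e1 : ‖D k‖ = (2 * (z k).re) * ∏ j ∈ S.erase k, ‖z k + conj (z j)‖ := by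
      rw [← norm_add_conj_self (hz k hk), norm_prod,
        Finset.mul_prod_erase S (fun j => ‖z k + conj (z j)‖) hk]
    rw [Complex.norm_conj, norm_div, norm_mul, e1, finiteBlaschke_eq, norm_prod]
    field_simp
  · rw [← inner_cauchyKernel (hz k hk), inner_sum]
    have e2 : ∀ j ∈ S, inner ℂ (cauchyKernel (conj (z k))) (d j • cauchyKernel (conj (z j)))
        = d j * (conj (z j) + z k)⁻¹ := fun j hj => by
      rw [inner_smul_right, inner_cauchyKernel_cauchyKernel (conj_re_pos (hz k hk))
        (conj_re_pos (hz j hj)), Complex.conj_conj, add_comm]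
    rw [Finset.sum_congr rfl e2,
      ← hpf (z k) (fun j hj => add_conj_ne_zero (hz k hk) (hz j hj)), hPe,
      Finset.sum_eq_single_of_mem k hk]
    · change c k * N k / D k = τ k
      have := hN k hk
      have := hD k hk
      simp only [c]
      field_simp
    · intro j hj hjk
      rw [Finset.prod_eq_zero (Finset.mem_erase.2 ⟨hjk.symm, hk⟩) (sub_self _), mul_zero]
  · refine norm_le_norm_of_fourier ?_
    filter_upwards [fourier_sum_cauchyKernel S d (fun k => conj (z k))
        (fun k hk => conj_re_pos (hz k hk)),
      fourier_sum_cauchyKernel S (fun k => conj (c k)) (fun k => conj (z k))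
        (fun k hk => conj_re_pos (hz k hk))] with ξ h1 h2
    rw [h1, h2]
    have hne : ∀ j ∈ S, freq ξ + conj (z j) ≠ 0 := fun j hj => by
      rw [add_comm]; exact add_freq_ne_zero (conj_re_pos (hz j hj)) ξ
    have hne' : ∀ j ∈ S, freq ξ - z j ≠ 0 := fun j hj => by
      rw [← neg_sub]; exact neg_ne_zero.2 (sub_freq_ne_zero (hz j hj) ξ)
    rw [← hpf _ hne]
    have e3 : P.eval (freq ξ) = (∏ j ∈ S, (freq ξ - z j)) * ∑ k ∈ S, c k * (freq ξ - z k)⁻¹ := by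
      rw [hPe, Finset.mul_sum]
      refine Finset.sum_congr rfl fun k hk => ?_
      rw [← Finset.mul_prod_erase S _ hk]
      have := hne' k hk
      field_simp
    have e4 : ∏ j ∈ S, ‖freq ξ + conj (z j)‖ = ∏ j ∈ S, ‖freq ξ - z j‖ :=
      Finset.prod_congr rfl fun j _ => norm_freq_add_conj ξ (z j)
    -- Reflecting the poles by conjugation on the axis leaves the modulus unchanged and turns the
    -- sum into Cauchy kernels of causal functions.
    have e5 : ‖∑ k ∈ S, conj (c k) * (conj (z k) + freq ξ)⁻¹‖
        = ‖∑ k ∈ S, c k * (freq ξ - z k)⁻¹‖ := by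
      rw [← Complex.norm_conj, map_sum, ← norm_neg, ← Finset.sum_neg_distrib]
      congr 1
      refine Finset.sum_congr rfl fun k _ => ?_
      rw [map_mul, Complex.conj_conj, map_inv₀, map_add, Complex.conj_conj, conj_freq,
        ← mul_neg, ← inv_neg]
      congr 2; ring
    have e6 : ∏ j ∈ S, ‖freq ξ - z j‖ ≠ 0 :=
      Finset.prod_ne_zero_iff.2 fun j hj => norm_ne_zero_iff.2 (hne' j hj)
    rw [e5, e3, norm_div, norm_mul, norm_prod, norm_prod, e4, mul_div_right_comm, div_self e6,
      one_mul]

/-- The residue pairing of a causal function with a reproducing kernel divided by the Blaschke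
product. -/
theorem exists_residue_pairing {ι : Type*} [DecidableEq ι] (S : Finset ι) (z : ι → ℂ)
    (hz : ∀ k ∈ S, 0 < (z k).re) (hinj : Set.InjOn z S) {w : ℂ} (hw : 0 < w.re) :
    ∃ ρ : ι → ℂ,
      (∀ k ∈ S, ‖ρ k‖ = 2 * (z k).re / finiteBlaschke z S k / ‖z k + conj w‖) ∧
      ∀ h : Lp ℂ 2 (volume : Measure ℝ), IsCausal h →
        ‖∑ k ∈ S, ρ k * laplace h (z k)‖ ^ 2 ≤ (2 * w.re)⁻¹ * ‖h‖ ^ 2 := by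
  -- The poles of `1/((s + conj w) B_S(s))`: `none` is the pole `-conj w` in the left half-plane,
  -- `some k` the node `z_k` in the right one.
  let v : Option ι → ℂ := fun i => i.elim (-conj w) z
  let S' : Finset (Option ι) := Finset.insertNone S
  let P : Polynomial ℂ := ∏ j ∈ S, (Polynomial.X - Polynomial.C (-conj (z j)))
  have hPe : ∀ s, P.eval s = ∏ j ∈ S, (s + conj (z j)) := fun s => by
    simp [P, Polynomial.eval_prod]
  have hPd : P.degree < S'.card := by
    have h1 : P.degree = (S.card : ℕ) := by
      simp only [P]
      rw [← Lagrange.nodal_eq, Lagrange.degree_nodal]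
    rw [h1]
    simp only [S', Finset.card_insertNone]
    exact_mod_cast Nat.lt_succ_self _
  have hv : Set.InjOn v S' := by
    intro i hi j hj h
    cases i <;> cases j
    · rfl
    · rename_i j
      have hj : j ∈ S := by simpa [S'] using hj
      exact absurd (by simp [v] at h; simp [← h]) (add_conj_ne_zero (hz j hj) hw)
    · rename_i j
      have hj : j ∈ S := by simpa [S'] using hi
      exact absurd (by simp [v] at h; simp [h]) (add_conj_ne_zero (hz j hj) hw)
    · rename_i i j
      rw [hinj (by simpa [S'] using hi) (by simpa [S'] using hj) h]
  let r : Option ι → ℂ := fun j => P.eval (v j) / (∏ i ∈ S'.erase j, (v j - v i))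
  have hpf : ∀ ξ : ℝ, (∏ j ∈ S, (freq ξ + conj (z j))) /
      ((freq ξ + conj w) * ∏ j ∈ S, (freq ξ - z j))
        = r none * (conj w + freq ξ)⁻¹ - ∑ k ∈ S, r (some k) * (z k - freq ξ)⁻¹ := by
    intro ξ
    have h := partial_fractions S' v hv P hPd (freq ξ) ?_
    · simp only [S', Finset.prod_insertNone, Finset.sum_insertNone] at h
      rw [← hPe]
      simp only [v, Option.elim, sub_neg_eq_add] at h
      refine h.trans ?_
      rw [sub_eq_add_neg, ← Finset.sum_neg_distrib]
      congr 1
      · simp only [r, v, S', Option.elim, div_eq_mul_inv]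
        rw [add_comm (freq ξ)]
      · refine Finset.sum_congr rfl fun k _ => ?_
        simp only [r, v, S', Option.elim, div_eq_mul_inv]
        rw [← mul_neg, ← inv_neg, neg_sub]
    · intro j hj h
      cases j
      · simp only [v, Option.elim] at h
        exact add_freq_ne_zero (conj_re_pos hw) ξ (by rw [h]; simp)
      · rename_i j
        simp only [v, Option.elim] at h
        exact sub_freq_ne_zero (hz j (by simpa [S'] using hj)) ξ (by rw [h]; simp)
  refine ⟨fun k => r (some k), fun k hk => ?_, fun h hh => ?_⟩
  · have e1 : S'.erase (some k) = Finset.insertNone (S.erase k) := by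
      ext i; cases i <;> simp [S', Finset.mem_insertNone]
    simp only [r]
    rw [e1, Finset.prod_insertNone, hPe]
    simp only [v, Option.elim, sub_neg_eq_add]
    rw [norm_div, norm_mul, norm_prod, norm_prod, finiteBlaschke_eq,
      ← Finset.mul_prod_erase S _ hk, norm_add_conj_self (hz k hk)]
    field_simp
  -- `Q` represents the whole function in the inner product. The pole at `-conj w` contributes an
  -- anticausal kernel, invisible to the causal `h`, so only the residues at the nodes remain.
  · let Q : Lp ℂ 2 (volume : Measure ℝ) :=
      (∑ k ∈ S, conj (r (some k)) • cauchyKernel (conj (z k))) -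
        conj (r none) • anticausalKernel w
    have e1 : inner ℂ Q h = ∑ k ∈ S, r (some k) * laplace h (z k) := by
      rw [inner_sub_left, inner_smul_left, hh.inner_anticausalKernel hw, mul_zero, sub_zero,
        sum_inner]
      refine Finset.sum_congr rfl fun k hk => ?_
      rw [inner_smul_left, Complex.conj_conj, inner_cauchyKernel (hz k hk)]
    have e2 : ‖Q‖ ≤ ‖cauchyKernel (conj w)‖ := by
      refine norm_le_norm_of_fourier ?_
      have e3 : (𝓕 Q : Lp ℂ 2 (volume : Measure ℝ))
          = 𝓕 (∑ k ∈ S, conj (r (some k)) • cauchyKernel (conj (z k)))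
            - conj (r none) • (𝓕 (anticausalKernel w) : Lp ℂ 2 (volume : Measure ℝ)) := by
        change Lp.fourierTransformₗᵢ ℝ ℂ _ = Lp.fourierTransformₗᵢ ℝ ℂ _ -
          _ • Lp.fourierTransformₗᵢ ℝ ℂ _
        simp only [Q, map_sub, map_smul]
      rw [e3]
      filter_upwards [Lp.coeFn_sub (𝓕 (∑ k ∈ S, conj (r (some k)) • cauchyKernel (conj (z k))))
          (conj (r none) • (𝓕 (anticausalKernel w) : Lp ℂ 2 (volume : Measure ℝ))),
        Lp.coeFn_smul (conj (r none)) (𝓕 (anticausalKernel w) : Lp ℂ 2 (volume : Measure ℝ)),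
        fourier_anticausalKernel hw, fourier_cauchyKernel (conj_re_pos hw),
        fourier_sum_cauchyKernel S (fun k => conj (r (some k))) (fun k => conj (z k))
          (fun k hk => conj_re_pos (hz k hk))] with ξ h1 h2 h3 h4 h5
      rw [h1, Pi.sub_apply, h2, Pi.smul_apply, h3, h4, h5, smul_eq_mul]
      have e4 : (∑ k ∈ S, conj (r (some k)) * (conj (z k) + freq ξ)⁻¹) -
          conj (r none) * (w - freq ξ)⁻¹
          = -conj (r none * (conj w + freq ξ)⁻¹ - ∑ k ∈ S, r (some k) * (z k - freq ξ)⁻¹) := by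
        simp only [map_sub, map_mul, map_sum, map_inv₀, map_add, Complex.conj_conj, conj_freq,
          neg_sub, sub_neg_eq_add, ← sub_eq_add_neg]
      rw [e4, norm_neg, Complex.norm_conj, ← hpf, norm_div, norm_mul, norm_prod, norm_prod]
      have e5 : ∏ j ∈ S, ‖freq ξ + conj (z j)‖ = ∏ j ∈ S, ‖freq ξ - z j‖ :=
        Finset.prod_congr rfl fun j _ => norm_freq_add_conj ξ (z j)
      have e6 : ∏ j ∈ S, ‖freq ξ - z j‖ ≠ 0 :=
        Finset.prod_ne_zero_iff.2 fun j hj => norm_ne_zero_iff.2 (by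
          rw [← neg_sub]; exact neg_ne_zero.2 (sub_freq_ne_zero (hz j hj) ξ))
      rw [e5, norm_inv, div_mul_cancel_right₀ e6, add_comm]
    rw [← e1]
    calc _ ≤ (‖Q‖ * ‖h‖) ^ 2 := by gcongr; exact norm_inner_le_norm _ _
      _ = ‖Q‖ ^ 2 * ‖h‖ ^ 2 := by ring
      _ ≤ ‖cauchyKernel (conj w)‖ ^ 2 * ‖h‖ ^ 2 := by gcongr
      _ = _ := by rw [norm_cauchyKernel_sq (conj_re_pos hw)]; simp

/-! ### The Carleson embedding through a Poisson-type kernel -/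

/-- The `ℓ¹` distance from `z` to the reflection of `w` in the imaginary axis. -/
def reflDist (z w : ℂ) : ℝ := z.re + w.re + |z.im - w.im|

/-- The Poisson-type kernel `Re z / d(z, w)²`, restricted to `Re w ≤ Re z`. -/
def poissonKer (z w : ℂ) : ℝ := if w.re ≤ z.re then z.re / reflDist z w ^ 2 else 0

theorem reflDist_comm (z w : ℂ) : reflDist z w = reflDist w z := by
  rw [reflDist, reflDist, abs_sub_comm, add_comm z.re]

theorem reflDist_pos {z w : ℂ} (hz : 0 < z.re) (hw : 0 < w.re) : 0 < reflDist z w := by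
  unfold reflDist; positivity

theorem reflDist_triangle {a b c : ℂ} (hc : 0 < c.re) :
    reflDist a b ≤ reflDist a c + reflDist b c := by
  have := abs_sub_le a.im c.im b.im
  rw [abs_sub_comm c.im] at this
  unfold reflDist; linarith

theorem poissonKer_nonneg {z : ℂ} (hz : 0 < z.re) (w : ℂ) : 0 ≤ poissonKer z w := by
  unfold poissonKer; split_ifs <;> positivity

theorem div_sq_le_poisson {x d e : ℝ} (hx : 0 ≤ x) (hd : 0 < d) (he : 0 < e) (h : d ≤ 2 * e) :
    x / e ^ 2 ≤ 4 * (x / d ^ 2) := by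
  rw [div_le_iff₀ (by positivity), mul_assoc, div_mul_eq_mul_div, ← mul_div_assoc,
    le_div_iff₀ (by positivity)]
  have : d ^ 2 ≤ 4 * e ^ 2 := by nlinarith
  nlinarith

/-- By the triangle inequality the larger of the distances to `c` is at least half of `reflDist b
a`. The factor carrying that distance is then at most `4 * poissonKer b a`, since its numerator is
at most `b.re`; the other factor is kept. -/
theorem poissonKer_mul_le_of_le {a b c : ℂ} (ha : 0 < a.re) (hb : 0 < b.re) (hc : 0 < c.re)
    (hab : a.re ≤ b.re) (hca : c.re ≤ a.re) :
    poissonKer a c * poissonKer b c ≤ 4 * (poissonKer a c + poissonKer b c) * poissonKer b a := by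
  have h1 := poissonKer_nonneg ha c
  have h2 := poissonKer_nonneg hb c
  have h3 := poissonKer_nonneg hb a
  have t := reflDist_triangle (a := b) (b := a) hc
  have d1 := reflDist_pos ha hc
  have d2 := reflDist_pos hb hc
  have d3 := reflDist_pos hb ha
  rcases le_total (reflDist a c) (reflDist b c) with h | h
  · have : poissonKer b c ≤ 4 * poissonKer b a := by
      rw [poissonKer, poissonKer, if_pos (hca.trans hab), if_pos hab]
      exact div_sq_le_poisson hb.le d3 d2 (by linarith)
    nlinarith
  · have : poissonKer a c ≤ 4 * poissonKer b a := by
      rw [poissonKer, poissonKer, if_pos hca, if_pos hab]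
      refine (div_sq_le_poisson ha.le d3 d1 (by linarith)).trans ?_
      gcongr
    nlinarith

theorem poissonKer_mul_le {a b c : ℂ} (ha : 0 < a.re) (hb : 0 < b.re) (hc : 0 < c.re) :
    poissonKer a c * poissonKer b c
      ≤ 4 * (poissonKer a c + poissonKer b c) * (poissonKer b a + poissonKer a b) := by
  have h1 := poissonKer_nonneg ha c
  have h2 := poissonKer_nonneg hb c
  have h3 := poissonKer_nonneg hb a
  have h4 := poissonKer_nonneg ha b
  by_cases hca : c.re ≤ a.re
  · by_cases hcb : c.re ≤ b.re
    · rcases le_total a.re b.re with h | h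
      · have := poissonKer_mul_le_of_le ha hb hc h hca
        nlinarith
      · have := poissonKer_mul_le_of_le hb ha hc h hcb
        nlinarith
    · rw [show poissonKer b c = 0 from if_neg hcb]
      simp only [mul_zero, add_zero]
      positivity
  · rw [show poissonKer a c = 0 from if_neg hca]
    simp only [zero_mul, zero_add]
    positivity

/-- The Carleson condition bounds the integrals of the kernel. -/
theorem sum_poissonKer_le {ι : Type*} (S : Finset ι) (z : ι → ℂ) (m : ι → ℝ) {κ : ℝ} (hκ : 0 ≤ κ)
    (hz : ∀ k ∈ S, 0 < (z k).re) (hm : ∀ k ∈ S, 0 ≤ m k)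
    (hC : ∀ c L : ℝ, 0 < L →
      ∑ k ∈ S with |(z k).im - c| ≤ L ∧ (z k).re < 2 * L, m k ≤ κ * (2 * L))
    {a : ℂ} (ha : 0 < a.re) :
    ∑ k ∈ S, m k * poissonKer a (z k) ≤ 8 * κ := by
  obtain ⟨N, hN⟩ : ∃ N : ℕ, ∀ k ∈ S, reflDist a (z k) < 2 ^ N * a.re := by
    obtain ⟨R, hR⟩ := (S.finite_toSet.image fun k => reflDist a (z k) / a.re).bddAbove
    obtain ⟨N, hN⟩ := pow_unbounded_of_one_lt R (one_lt_two (α := ℝ))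
    refine ⟨N, fun k hk => ?_⟩
    have := hR (mem_image_of_mem (fun k => reflDist a (z k) / a.re) hk)
    rw [← div_lt_iff₀ ha]
    exact this.trans_lt hN
  -- Dyadic annuli `2^n a.re ≤ d < 2^(n+1) a.re`. As `d ≥ a.re`, they start at `n = 0`. On the
  -- `n`-th one the kernel is at most `4^{-n} / a.re`, while the enclosing square has mass at most
  -- `4 κ 2^n a.re`; the products `4 κ 2^{-n}` sum to at most `8 κ`.
  let cnd : ℕ → ι → Prop := fun n k =>
    |(z k).im - a.im| ≤ 2 ^ (n + 1) * a.re ∧ (z k).re < 2 * (2 ^ (n + 1) * a.re)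
  classical
  have hpt : ∀ k ∈ S, m k * poissonKer a (z k)
      ≤ ∑ n ∈ Finset.range N, if cnd n k then m k * ((1 / 4) ^ n / a.re) else 0 := by
    intro k hk
    have hmk := hm k hk
    have hnn : ∀ n ∈ Finset.range N, 0 ≤ if cnd n k then m k * ((1 / 4) ^ n / a.re) else 0 :=
      fun n _ => by split_ifs <;> positivity
    by_cases hle : (z k).re ≤ a.re
    · have hd := reflDist_pos ha (hz k hk)
      have h1 : 1 ≤ reflDist a (z k) / a.re := by
        rw [le_div_iff₀ ha, one_mul]
        have := hz k hk
        have := abs_nonneg (a.im - (z k).im)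
        unfold reflDist; linarith
      obtain ⟨n, hn1, hn2⟩ := exists_nat_pow_near h1 (one_lt_two (α := ℝ))
      rw [le_div_iff₀ ha] at hn1
      rw [div_lt_iff₀ ha] at hn2
      have hnN : n < N := by
        have : (2 : ℝ) ^ n * a.re < 2 ^ N * a.re := hn1.trans_lt (hN k hk)
        exact (pow_lt_pow_iff_right₀ one_lt_two).1 (lt_of_mul_lt_mul_right this ha.le)
      have hc : cnd n k := by
        have h2 := hz k hk
        refine ⟨?_, ?_⟩
        · rw [abs_sub_comm]
          unfold reflDist at hn2; linarith
        · have : (1 : ℝ) ≤ 2 ^ (n + 1) := one_le_pow₀ one_le_two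
          nlinarith
      refine le_trans ?_ (Finset.single_le_sum hnn (Finset.mem_range.2 hnN))
      rw [if_pos hc, poissonKer, if_pos hle]
      refine mul_le_mul_of_nonneg_left ?_ hmk
      rw [div_le_div_iff₀ (by positivity) ha, one_div, inv_pow, show (4 : ℝ) = 2 ^ 2 by norm_num,
        ← pow_mul, mul_comm 2 n, pow_mul, ← div_eq_inv_mul, le_div_iff₀ (by positivity)]
      calc a.re * a.re * (2 ^ n) ^ 2 = (2 ^ n * a.re) ^ 2 := by ring
        _ ≤ _ := by gcongr
    · rw [poissonKer, if_neg hle, mul_zero]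
      exact Finset.sum_nonneg hnn
  calc _ ≤ ∑ k ∈ S, ∑ n ∈ Finset.range N, if cnd n k then m k * ((1 / 4) ^ n / a.re) else 0 :=
        Finset.sum_le_sum hpt
    _ = ∑ n ∈ Finset.range N, ∑ k ∈ S, if cnd n k then m k * ((1 / 4) ^ n / a.re) else 0 :=
        Finset.sum_comm
    _ ≤ ∑ n ∈ Finset.range N, 4 * κ * (1 / 2) ^ n := by
        refine Finset.sum_le_sum fun n _ => ?_
        rw [← Finset.sum_filter, ← Finset.sum_mul]
        have h := hC a.im (2 ^ (n + 1) * a.re) (by positivity)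
        calc _ ≤ κ * (2 * (2 ^ (n + 1) * a.re)) * ((1 / 4) ^ n / a.re) := by
              gcongr
          _ = _ := by
            rw [show (1 / 4 : ℝ) = (1 / 2) * (1 / 2) by norm_num, mul_pow, pow_succ]
            have : (2 : ℝ) ^ n * (1 / 2) ^ n = 1 := by rw [← mul_pow]; norm_num
            have ha' : a.re * a.re⁻¹ = 1 := mul_inv_cancel₀ ha.ne'
            rw [div_eq_mul_inv]
            linear_combination
              (4 * κ * (1 / 2) ^ n) * (a.re * a.re⁻¹) * this + (4 * κ * (1 / 2) ^ n) * ha'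
    _ ≤ 8 * κ := by
        rw [← Finset.mul_sum]
        have : ∑ n ∈ Finset.range N, (1 / 2 : ℝ) ^ n ≤ 2 := by
          rw [geom_sum_eq (by norm_num)]
          have : (0 : ℝ) ≤ (1 / 2) ^ N := by positivity
          rw [div_le_iff_of_neg (by norm_num)]
          linarith
        nlinarith

/-- A kernel with bounded integrals which dominates its own products is bounded on `ℓ²`. -/
theorem sum_sum_poissonKer_le {ι : Type*} (S : Finset ι) (z : ι → ℂ) (m g : ι → ℝ) {A : ℝ}
    (hz : ∀ k ∈ S, 0 < (z k).re) (hm : ∀ k ∈ S, 0 ≤ m k) (hg : ∀ k ∈ S, 0 ≤ g k)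
    (hA : ∀ j ∈ S, ∑ k ∈ S, m k * poissonKer (z j) (z k) ≤ A) :
    ∑ j ∈ S, ∑ k ∈ S, m j * g j * (m k * g k) * poissonKer (z j) (z k)
      ≤ 16 * A * ∑ k ∈ S, m k * g k ^ 2 := by
  set M : ι → ι → ℝ := fun j k => poissonKer (z j) (z k) with hM
  have hM0 : ∀ j ∈ S, ∀ k, 0 ≤ M j k := fun j hj k => poissonKer_nonneg (hz j hj) _
  set N : ι → ℝ := fun k => ∑ j ∈ S, m j * g j * M j k with hN
  set Q : ℝ := ∑ k ∈ S, m k * g k * N k with hQ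
  set G : ℝ := ∑ k ∈ S, m k * g k ^ 2 with hG
  have hN0 : ∀ k, 0 ≤ N k := fun k => Finset.sum_nonneg fun j hj =>
    mul_nonneg (mul_nonneg (hm j hj) (hg j hj)) (hM0 j hj k)
  have hQ0 : 0 ≤ Q := Finset.sum_nonneg fun k hk =>
    mul_nonneg (mul_nonneg (hm k hk) (hg k hk)) (hN0 k)
  have hG0 : 0 ≤ G := Finset.sum_nonneg fun k hk => mul_nonneg (hm k hk) (sq_nonneg _)
  have hQeq : ∑ j ∈ S, ∑ k ∈ S, m j * g j * (m k * g k) * M j k = Q := by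
    rw [Finset.sum_comm, hQ]
    refine Finset.sum_congr rfl fun k _ => ?_
    rw [hN, Finset.mul_sum]
    exact Finset.sum_congr rfl fun j _ => by ring
  -- Expanding the square produces products of two kernel values with a common second argument. The
  -- product inequality trades them for sums in which that argument can be integrated out, at cost
  -- `A` each, leaving the form `Q` itself.
  have h1 : ∑ k ∈ S, m k * N k ^ 2 ≤ 16 * A * Q := by
    calc ∑ k ∈ S, m k * N k ^ 2
        = ∑ k ∈ S, ∑ i ∈ S, ∑ j ∈ S, m k * ((m i * g i * M i k) * (m j * g j * M j k)) := by
          refine Finset.sum_congr rfl fun k _ => ?_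
          rw [sq, hN, Finset.sum_mul_sum, Finset.mul_sum]
          exact Finset.sum_congr rfl fun i _ => by rw [Finset.mul_sum]
      _ ≤ ∑ k ∈ S, ∑ i ∈ S, ∑ j ∈ S, (m i * g i * (m j * g j)) *
            (4 * (m k * M i k + m k * M j k) * (M j i + M i j)) := by
          refine Finset.sum_le_sum fun k hk => Finset.sum_le_sum fun i hi =>
            Finset.sum_le_sum fun j hj => ?_
          have h := poissonKer_mul_le (hz i hi) (hz j hj) (hz k hk)
          have h0 : 0 ≤ m i * g i * (m j * g j) * m k :=
            mul_nonneg (mul_nonneg (mul_nonneg (hm i hi) (hg i hi))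
              (mul_nonneg (hm j hj) (hg j hj))) (hm k hk)
          have h' := mul_le_mul_of_nonneg_left h h0
          simp only [hM]
          linarith
      _ = ∑ i ∈ S, ∑ j ∈ S, (m i * g i * (m j * g j)) *
            (4 * (∑ k ∈ S, m k * M i k + ∑ k ∈ S, m k * M j k) * (M j i + M i j)) := by
          rw [Finset.sum_comm]
          refine Finset.sum_congr rfl fun i _ => ?_
          rw [Finset.sum_comm]
          refine Finset.sum_congr rfl fun j _ => ?_
          rw [← Finset.sum_add_distrib, ← Finset.mul_sum, ← Finset.sum_mul, ← Finset.mul_sum]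
      _ ≤ ∑ i ∈ S, ∑ j ∈ S, (m i * g i * (m j * g j)) * (4 * (A + A) * (M j i + M i j)) := by
          refine Finset.sum_le_sum fun i hi => Finset.sum_le_sum fun j hj => ?_
          have h0 := mul_nonneg (mul_nonneg (hm i hi) (hg i hi)) (mul_nonneg (hm j hj) (hg j hj))
          have h2 := hM0 i hi j
          have h3 := hM0 j hj i
          gcongr
          · exact hA i hi
          · exact hA j hj
      _ = 8 * A * (∑ i ∈ S, ∑ j ∈ S, m j * g j * (m i * g i) * M j i +
            ∑ i ∈ S, ∑ j ∈ S, m i * g i * (m j * g j) * M i j) := by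
          rw [← Finset.sum_add_distrib, Finset.mul_sum]
          refine Finset.sum_congr rfl fun i _ => ?_
          rw [← Finset.sum_add_distrib, Finset.mul_sum]
          exact Finset.sum_congr rfl fun j _ => by ring
      _ = 16 * A * Q := by
          rw [hQeq, Finset.sum_comm, hQeq]; ring
  -- Cauchy-Schwarz closes the loop: `Q² ≤ 16 A G Q`, and one factor `Q` cancels when it is
  -- positive.
  have h2 : Q ^ 2 ≤ G * ∑ k ∈ S, m k * N k ^ 2 := by
    have h := Finset.sum_sq_le_sum_mul_sum_of_sq_le_mul S (r := fun k => m k * g k * N k)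
      (f := fun k => m k * g k ^ 2) (g := fun k => m k * N k ^ 2)
      (fun k hk => mul_nonneg (hm k hk) (sq_nonneg _))
      (fun k hk => mul_nonneg (hm k hk) (sq_nonneg _)) (fun k _ => le_of_eq (by ring))
    exact h
  rw [hQeq]
  rcases hQ0.eq_or_lt with h0 | h0
  · rw [← h0] at h1 ⊢
    rcases S.eq_empty_or_nonempty with rfl | ⟨j, hj⟩
    · simp [hG]
    · have : 0 ≤ A := (Finset.sum_nonneg fun k hk => mul_nonneg (hm k hk) (hM0 j hj k)).trans
        (hA j hj)
      positivity
  · have : Q * Q ≤ (16 * A * G) * Q := by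
      calc Q * Q = Q ^ 2 := by ring
        _ ≤ G * (16 * A * Q) := h2.trans (by gcongr)
        _ = _ := by ring
    exact le_of_mul_le_mul_right this h0

/-- The real part of the Cauchy kernel at `a + conj b` has numerator `a.re + b.re`, at most twice
the larger real part, and its denominator is comparable to `reflDist a b ^ 2`. Full Cauchy kernels
would decay too slowly. -/
theorem re_inv_add_conj_le {a b : ℂ} (ha : 0 < a.re) (hb : 0 < b.re) :
    |((a + conj b)⁻¹).re| ≤ 4 * (poissonKer a b + poissonKer b a) := by
  have hd := reflDist_pos ha hb
  have h1 := poissonKer_nonneg ha b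
  have h2 := poissonKer_nonneg hb a
  have hre : ((a + conj b)⁻¹).re = (a.re + b.re) / Complex.normSq (a + conj b) := by
    rw [Complex.inv_re]; simp
  have hn : reflDist a b ^ 2 / 2 ≤ Complex.normSq (a + conj b) := by
    rw [Complex.normSq_apply]
    simp only [Complex.add_re, Complex.add_im, Complex.conj_re, Complex.conj_im, reflDist,
      ← sub_eq_add_neg]
    have := sq_abs (a.im - b.im)
    nlinarith [sq_nonneg (a.re + b.re - |a.im - b.im|)]
  have hpos : 0 < reflDist a b ^ 2 / 2 := by positivity
  have h0 : 0 < Complex.normSq (a + conj b) := hpos.trans_le hn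
  rw [hre, abs_of_nonneg (by positivity)]
  have h3 : (a.re + b.re) / Complex.normSq (a + conj b)
      ≤ (a.re + b.re) / (reflDist a b ^ 2 / 2) := by gcongr
  refine h3.trans ?_
  have key : ∀ {c d : ℂ}, 0 < c.re → 0 < d.re → d.re ≤ c.re →
      (c.re + d.re) / (reflDist c d ^ 2 / 2) ≤ 4 * poissonKer c d := by
    intro c d hc hd hdc
    have := reflDist_pos hc hd
    rw [poissonKer, if_pos hdc, div_div_eq_mul_div, ← mul_div_assoc]
    exact div_le_div_of_nonneg_right (by linarith) (by positivity)
  rcases le_total b.re a.re with h | h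
  · linarith [key ha hb h]
  · have := key hb ha h
    rw [reflDist_comm, add_comm]
    linarith

/-- The dual form of the Carleson embedding theorem, for finitely many point masses. -/
theorem norm_sum_cauchyKernel_sq_le {ι : Type*} (S : Finset ι) (z : ι → ℂ) (m : ι → ℝ) {κ : ℝ}
    (hκ : 0 ≤ κ) (hz : ∀ k ∈ S, 0 < (z k).re) (hm : ∀ k ∈ S, 0 < m k)
    (hC : ∀ c L : ℝ, 0 < L →
      ∑ k ∈ S with |(z k).im - c| ≤ L ∧ (z k).re < 2 * L, m k ≤ κ * (2 * L)) (c : ι → ℂ) :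
    ‖∑ k ∈ S, c k • cauchyKernel (conj (z k))‖ ^ 2 ≤ 2048 * κ * ∑ k ∈ S, ‖c k‖ ^ 2 / m k := by
  -- For real coefficients only the real part of the Gram matrix `1/(z_j + conj z_k)` enters, and
  -- that part has Poisson decay. Complex coefficients are split into real and imaginary parts,
  -- which doubles the constant.
  have hreal : ∀ a : ι → ℝ, ‖∑ k ∈ S, (a k : ℂ) • cauchyKernel (conj (z k))‖ ^ 2
      ≤ 1024 * κ * ∑ k ∈ S, a k ^ 2 / m k := by
    intro a
    have e1 : ‖∑ k ∈ S, (a k : ℂ) • cauchyKernel (conj (z k))‖ ^ 2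
        = ∑ j ∈ S, ∑ k ∈ S, a j * a k * ((z j + conj (z k))⁻¹).re := by
      rw [← inner_self_eq_norm_sq (𝕜 := ℂ), sum_inner, map_sum]
      refine Finset.sum_congr rfl fun j hj => ?_
      rw [inner_sum, map_sum]
      refine Finset.sum_congr rfl fun k hk => ?_
      rw [inner_smul_left, inner_smul_right, inner_cauchyKernel_cauchyKernel
        (conj_re_pos (hz j hj)) (conj_re_pos (hz k hk)), Complex.conj_conj, Complex.conj_ofReal,
        ← mul_assoc, ← Complex.ofReal_mul]
      exact Complex.re_ofReal_mul _ _
    have h := sum_sum_poissonKer_le S z m (fun k => |a k| / m k) (A := 8 * κ) hz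
      (fun k hk => (hm k hk).le) (fun k hk => div_nonneg (abs_nonneg _) (hm k hk).le)
      (fun j hj => sum_poissonKer_le S z m hκ hz (fun k hk => (hm k hk).le) hC (hz j hj))
    have e2 : ∑ j ∈ S, ∑ k ∈ S, m j * (|a j| / m j) * (m k * (|a k| / m k)) *
        poissonKer (z j) (z k) = ∑ j ∈ S, ∑ k ∈ S, |a j| * |a k| * poissonKer (z j) (z k) := by
      refine Finset.sum_congr rfl fun j hj => Finset.sum_congr rfl fun k hk => ?_
      rw [mul_div_cancel₀ _ (hm j hj).ne', mul_div_cancel₀ _ (hm k hk).ne']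
    have e3 : ∑ k ∈ S, m k * (|a k| / m k) ^ 2 = ∑ k ∈ S, a k ^ 2 / m k := by
      refine Finset.sum_congr rfl fun k hk => ?_
      have := (hm k hk).ne'
      rw [div_pow, sq_abs]
      field_simp
    rw [e2, e3] at h
    rw [e1]
    calc _ ≤ ∑ j ∈ S, ∑ k ∈ S, (4 * (|a j| * |a k| * poissonKer (z j) (z k)) +
          4 * (|a k| * |a j| * poissonKer (z k) (z j))) := by
          refine Finset.sum_le_sum fun j hj => Finset.sum_le_sum fun k hk => ?_
          have h1 := re_inv_add_conj_le (hz j hj) (hz k hk)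
          calc _ ≤ |a j * a k * ((z j + conj (z k))⁻¹).re| := le_abs_self _
            _ = |a j| * |a k| * |((z j + conj (z k))⁻¹).re| := by rw [abs_mul, abs_mul]
            _ ≤ |a j| * |a k| * (4 * (poissonKer (z j) (z k) + poissonKer (z k) (z j))) := by
              gcongr
            _ = _ := by ring
      _ = 8 * ∑ j ∈ S, ∑ k ∈ S, |a j| * |a k| * poissonKer (z j) (z k) := by
          simp only [Finset.sum_add_distrib]
          rw [Finset.sum_comm (f := fun j k => 4 * (|a k| * |a j| * poissonKer (z k) (z j)))]
          simp only [← Finset.mul_sum]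
          ring
      _ ≤ _ := by nlinarith
  have e : ∑ k ∈ S, c k • cauchyKernel (conj (z k))
      = (∑ k ∈ S, ((c k).re : ℂ) • cauchyKernel (conj (z k))) +
        Complex.I • ∑ k ∈ S, ((c k).im : ℂ) • cauchyKernel (conj (z k)) := by
    rw [Finset.smul_sum, ← Finset.sum_add_distrib]
    refine Finset.sum_congr rfl fun k _ => ?_
    rw [smul_smul, ← add_smul, mul_comm Complex.I, Complex.re_add_im]
  have h1 := hreal fun k => (c k).re
  have h2 := hreal fun k => (c k).im
  have e2 : ∑ k ∈ S, ‖c k‖ ^ 2 / m k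
      = ∑ k ∈ S, (c k).re ^ 2 / m k + ∑ k ∈ S, (c k).im ^ 2 / m k := by
    rw [← Finset.sum_add_distrib]
    refine Finset.sum_congr rfl fun k _ => ?_
    rw [← Complex.normSq_eq_norm_sq, Complex.normSq_apply, ← add_div]
    ring_nf
  rw [e, e2]
  set u := ∑ k ∈ S, ((c k).re : ℂ) • cauchyKernel (conj (z k))
  set v := ∑ k ∈ S, ((c k).im : ℂ) • cauchyKernel (conj (z k))
  have h3 : ‖u + Complex.I • v‖ ≤ ‖u‖ + ‖v‖ := by
    refine (norm_add_le _ _).trans ?_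
    rw [norm_smul, Complex.norm_I, one_mul]
  have h4 : ‖u + Complex.I • v‖ ^ 2 ≤ (‖u‖ + ‖v‖) ^ 2 := by gcongr
  nlinarith [sq_nonneg (‖u‖ - ‖v‖)]

/-! ### Weighted interpolation in `ℓ²`: duality and compactness -/

theorem exists_causal_laplace_eq (h : Lp ℂ 2 (volume : Measure ℝ)) :
    ∃ h' : Lp ℂ 2 (volume : Measure ℝ), IsCausal h' ∧ ‖h'‖ ≤ ‖h‖ ∧
      ∀ z, laplace h' z = laplace h z := by
  have hm : MemLp ((Ioi (0 : ℝ)).indicator h) 2 := (Lp.memLp h).indicator measurableSet_Ioi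
  refine ⟨hm.toLp _, ?_, Lp.norm_le_norm_of_ae_le ?_, fun z => ?_⟩
  · filter_upwards [hm.coeFn_toLp] with t ht h0
    rw [ht, indicator_of_notMem (by simpa using h0.le)]
  · filter_upwards [hm.coeFn_toLp] with t ht
    rw [ht]; exact norm_indicator_le_norm_self _ _
  · rw [laplace, laplace]
    refine integral_congr_ae ?_
    filter_upwards [ae_restrict_mem measurableSet_Ioi, ae_restrict_of_ae hm.coeFn_toLp] with t h1 h2
    rw [h2, indicator_of_mem h1]

theorem lp_two_norm_sq {ι : Type*} (a : lp (fun _ : ι => ℂ) 2) :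
    HasSum (fun k => ‖a k‖ ^ 2) (‖a‖ ^ 2) := by
  have h := lp.hasSum_norm (p := 2) (by norm_num) a
  simpa using h

theorem lp_two_norm_sum_single_sq {ι : Type*} [DecidableEq ι] (c : ι → ℂ) (S : Finset ι) :
    ‖∑ k ∈ S, lp.single (E := fun _ : ι => ℂ) 2 k (c k)‖ ^ 2 = ∑ k ∈ S, ‖c k‖ ^ 2 := by
  have h := lp.norm_sum_single (p := 2) (E := fun _ : ι => ℂ) (by norm_num) c S
  simpa using h

theorem sum_single_apply {ι : Type*} [DecidableEq ι] (c : ι → ℂ) (S : Finset ι) {k : ι}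
    (hk : k ∈ S) : (∑ j ∈ S, lp.single (E := fun _ : ι => ℂ) 2 j (c j)) k = c k := by
  rw [lp.coeFn_sum, Finset.sum_apply, Finset.sum_eq_single_of_mem k hk]
  · exact lp.single_apply_self _ _ _
  · intro j _ hjk
    exact lp.single_apply_ne _ _ _ hjk.symm

/-- Interpolation of all of `ℓ²` is possible with norm control. -/
theorem exists_norm_le_of_interpolation {ι : Type*} {z γ : ι → ℂ} (hz : ∀ k, 0 < (z k).re)
    (hinterp : ∀ a : lp (fun _ : ι => ℂ) 2, ∃ h : Lp ℂ 2 (volume : Measure ℝ),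
      ∀ k, γ k * laplace h (z k) = a k) :
    ∃ C > 0, ∀ a : lp (fun _ : ι => ℂ) 2, ∃ h : Lp ℂ 2 (volume : Measure ℝ),
      IsCausal h ∧ ‖h‖ ≤ C * ‖a‖ ∧ ∀ k, γ k * laplace h (z k) = a k := by
  let E := Lp ℂ 2 (volume : Measure ℝ)
  let ℓ := lp (fun _ : ι => ℂ) 2
  let Φ : ι → E × ℓ →L[ℂ] ℂ := fun k =>
    (γ k • innerSL ℂ (cauchyKernel (conj (z k)))).comp (ContinuousLinearMap.fst ℂ E ℓ) -
      (lp.evalCLM ℂ (fun _ : ι => ℂ) 2 k).comp (ContinuousLinearMap.snd ℂ E ℓ)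
  -- The evaluation `h ↦ (γ_k ĥ(z_k))` need not map into `ℓ²`, so the open mapping theorem is
  -- applied to the projection of its closed graph onto the data.
  let W : Submodule ℂ (E × ℓ) := ⨅ k, (Φ k).ker
  have hW : ∀ p : E × ℓ, p ∈ W ↔ ∀ k, γ k * laplace p.1 (z k) = p.2 k := by
    intro p
    rw [Submodule.mem_iInf]
    refine forall_congr' fun k => ?_
    rw [← inner_cauchyKernel (hz k), LinearMap.mem_ker]
    change γ k * inner ℂ (cauchyKernel (conj (z k))) p.1 - p.2 k = 0 ↔ _
    rw [sub_eq_zero]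
  have hcl : IsClosed (W : Set (E × ℓ)) := by
    rw [Submodule.coe_iInf]
    exact isClosed_iInter fun k => (Φ k).isClosed_ker
  have : CompleteSpace W := hcl.completeSpace_coe
  let f : W →L[ℂ] ℓ := (ContinuousLinearMap.snd ℂ E ℓ).comp W.subtypeL
  have hf : Function.Surjective f := fun a => by
    obtain ⟨h, hh⟩ := hinterp a
    exact ⟨⟨(h, a), (hW _).2 hh⟩, rfl⟩
  obtain ⟨C, hC, hC'⟩ := f.exists_preimage_norm_le hf
  refine ⟨C, hC, fun a => ?_⟩
  obtain ⟨p, hp1, hp2⟩ := hC' a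
  obtain ⟨h', h1, h2, h3⟩ := exists_causal_laplace_eq p.1.1
  refine ⟨h', h1, h2.trans (le_trans (norm_fst_le p.1) hp2), fun k => ?_⟩
  rw [h3, (hW _).1 p.2 k, ← hp1]
  rfl

theorem ne_zero_of_interpolation {ι : Type*} {z γ : ι → ℂ}
    (hinterp : ∀ a : lp (fun _ : ι => ℂ) 2, ∃ h : Lp ℂ 2 (volume : Measure ℝ),
      ∀ k, γ k * laplace h (z k) = a k) (k : ι) : γ k ≠ 0 := by
  classical
  obtain ⟨h, hh⟩ := hinterp (lp.single 2 k 1)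
  intro h0
  have := hh k
  rw [h0, zero_mul, lp.single_apply_self] at this
  exact zero_ne_one this

theorem injective_of_interpolation {ι : Type*} {z γ : ι → ℂ}
    (hinterp : ∀ a : lp (fun _ : ι => ℂ) 2, ∃ h : Lp ℂ 2 (volume : Measure ℝ),
      ∀ k, γ k * laplace h (z k) = a k) : Function.Injective z := by
  classical
  intro j k hjk
  by_contra hne
  obtain ⟨h, hh⟩ := hinterp (lp.single 2 k 1)
  have h1 := hh j
  have h2 := hh k
  rw [lp.single_apply_ne _ _ _ hne] at h1
  rw [lp.single_apply_self] at h2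
  rw [hjk] at h1
  have h3 := (mul_eq_zero.1 h1).resolve_left (ne_zero_of_interpolation hinterp j)
  rw [h3, mul_zero] at h2
  exact zero_ne_one h2

/-- Interpolating data dual to the residues makes the residue pairing equal to the sum `σ` to be
estimated. With norm-controlled interpolation this reads `σ² ≤ (2 Re w)⁻¹ C² σ`, with `C`
independent of `S` and `w`. -/
theorem sum_le_of_interpolation {ι : Type*} [DecidableEq ι] {z γ : ι → ℂ}
    (hz : ∀ k, 0 < (z k).re)
    (hinterp : ∀ a : lp (fun _ : ι => ℂ) 2, ∃ h : Lp ℂ 2 (volume : Measure ℝ),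
      ∀ k, γ k * laplace h (z k) = a k) :
    ∃ C > 0, ∀ (S : Finset ι) (w : ℂ), 0 < w.re →
      ∑ k ∈ S, (2 * (z k).re / finiteBlaschke z S k / ‖z k + conj w‖ / ‖γ k‖) ^ 2
        ≤ C / (2 * w.re) := by
  obtain ⟨C, hC, h⟩ := exists_norm_le_of_interpolation hz hinterp
  refine ⟨C ^ 2, by positivity, fun S w hw => ?_⟩
  obtain ⟨ρ, hρ1, hρ2⟩ := exists_residue_pairing S z (fun k _ => hz k)
    (injective_of_interpolation hinterp).injOn hw
  let c : ι → ℂ := fun k => conj (ρ k / γ k)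
  obtain ⟨u, hu1, hu2, hu3⟩ := h (∑ k ∈ S, lp.single 2 k (c k))
  set σ : ℝ := ∑ k ∈ S, ‖ρ k / γ k‖ ^ 2 with hσ
  have hσ0 : 0 ≤ σ := Finset.sum_nonneg fun k _ => by positivity
  have e1 : ∑ k ∈ S, ρ k * laplace u (z k) = (σ : ℂ) := by
    rw [hσ, Complex.ofReal_sum]
    refine Finset.sum_congr rfl fun k hk => ?_
    have h1 := hu3 k
    rw [sum_single_apply c S hk] at h1
    have h2 := ne_zero_of_interpolation hinterp k
    rw [Complex.ofReal_pow, ← Complex.mul_conj', ← show c k = conj (ρ k / γ k) from rfl, ← h1]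
    field_simp
  have e2 : ‖u‖ ^ 2 ≤ C ^ 2 * σ := by
    calc _ ≤ (C * ‖∑ k ∈ S, lp.single (E := fun _ : ι => ℂ) 2 k (c k)‖) ^ 2 := by gcongr
      _ = _ := by
        rw [mul_pow, lp_two_norm_sum_single_sq]
        simp only [c, Complex.norm_conj, hσ]
  have e3 := hρ2 u hu1
  rw [e1, Complex.norm_real, Real.norm_eq_abs, sq_abs] at e3
  have e4 : σ = ∑ k ∈ S,
      (2 * (z k).re / finiteBlaschke z S k / ‖z k + conj w‖ / ‖γ k‖) ^ 2 :=
    Finset.sum_congr rfl fun k hk => by rw [norm_div, hρ1 k hk]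
  rw [← e4]
  rcases hσ0.eq_or_lt with h0 | h0
  · rw [← h0]; positivity
  · refine le_of_mul_le_mul_right ?_ h0
    calc σ * σ = σ ^ 2 := by ring
      _ ≤ (2 * w.re)⁻¹ * (C ^ 2 * σ) := e3.trans (by gcongr)
      _ = _ := by rw [div_eq_mul_inv]; ring

/-- Banach-Alaoglu and the finite intersection property: each condition is weak-* closed, and
finitely many of them meet in the ball of radius `R`. -/
theorem exists_of_forall_finset_inner {ι E : Type*} [NormedAddCommGroup E]
    [InnerProductSpace ℂ E] [CompleteSpace E] (e : ι → E) (τ : ι → ℂ) (R : ℝ)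
    (h : ∀ S : Finset ι, ∃ F : E, ‖F‖ ≤ R ∧ ∀ k ∈ S, inner ℂ (e k) F = τ k) :
    ∃ F : E, ∀ k, inner ℂ (e k) F = τ k := by
  have hc := WeakDual.isCompact_closedBall (𝕜 := ℂ) (E := E) 0 R
  obtain ⟨ℓ, -, hℓ⟩ := hc.inter_iInter_nonempty
    (fun k => {ℓ : WeakDual ℂ E | ℓ (e k) = conj (τ k)})
    (fun k => isClosed_eq (WeakDual.eval_continuous (e k)) continuous_const) (fun S => by
      obtain ⟨F, hF1, hF2⟩ := h S
      refine ⟨StrongDual.toWeakDual (InnerProductSpace.toDual ℂ E F), ?_, ?_⟩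
      · simpa using hF1
      · simp only [mem_iInter]
        intro k hk
        change inner ℂ F (e k) = conj (τ k)
        rw [← hF2 k hk, inner_conj_symm])
  refine ⟨(InnerProductSpace.toDual ℂ E).symm (WeakDual.toStrongDual ℓ), fun k => ?_⟩
  have := mem_iInter.1 hℓ k
  rw [← inner_conj_symm, InnerProductSpace.toDual_symm_apply]
  change conj (ℓ (e k)) = τ k
  rw [show ℓ (e k) = conj (τ k) from this, Complex.conj_conj]

/-- Sufficiency of the Carleson condition for interpolation. -/
theorem exists_interpolant {ι : Type*} [DecidableEq ι] {z γ : ι → ℂ} (hz : ∀ k, 0 < (z k).re)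
    (hγ : ∀ k, γ k ≠ 0) (hinj : Function.Injective z) {b : ι → ℝ} (hb : ∀ k, 0 < b k)
    (hbS : ∀ S k, b k ≤ finiteBlaschke z S k) {κ : ℝ} (hκ : 0 ≤ κ)
    (hC : ∀ (S : Finset ι) (c L : ℝ), 0 < L →
      ∑ k ∈ S with |(z k).im - c| ≤ L ∧ (z k).re < 2 * L, (2 * (z k).re / b k / ‖γ k‖) ^ 2
        ≤ κ * (2 * L)) (a : lp (fun _ : ι => ℂ) 2) :
    ∃ h : Lp ℂ 2 (volume : Measure ℝ), IsCausal h ∧ ∀ k, γ k * laplace h (z k) = a k := by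
  have hm : ∀ k, 0 < (2 * (z k).re / b k / ‖γ k‖) ^ 2 := fun k => by
    have := hz k
    have := hb k
    have := norm_pos_iff.2 (hγ k)
    positivity
  obtain ⟨F, hF⟩ := exists_of_forall_finset_inner
    (fun k => cauchyKernel (conj (z k))) (fun k => a k / γ k)
    (Real.sqrt (2048 * κ * ‖a‖ ^ 2)) (fun S => by
      obtain ⟨c, hc, F, hF1, hF2⟩ := exists_finite_interpolant S z (fun k _ => hz k)
        hinj.injOn (fun k => a k / γ k)
      refine ⟨F, ?_, fun k hk => by rw [inner_cauchyKernel (hz k), hF1 k hk]⟩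
      apply Real.le_sqrt_of_sq_le
      have h1 := norm_sum_cauchyKernel_sq_le S z
        (fun k => (2 * (z k).re / b k / ‖γ k‖) ^ 2) hκ (fun k _ => hz k) (fun k _ => hm k)
        (hC S) c
      -- The infinite product is below every finite one, so `|c_k|² / m_k ≤ |a_k|²`. This removes
      -- the dependence on `S` from the norm bound.
      have h2 : ∑ k ∈ S, ‖c k‖ ^ 2 / (2 * (z k).re / b k / ‖γ k‖) ^ 2 ≤ ‖a‖ ^ 2 := by
        refine le_trans (Finset.sum_le_sum fun k hk => ?_)
          (sum_le_hasSum S (fun k _ => by positivity) (lp_two_norm_sq a))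
        rw [div_le_iff₀ (hm k), ← mul_pow, hc k hk, norm_div]
        have h3 := hz k
        have h4 := hb k
        have h5 := norm_pos_iff.2 (hγ k)
        have h6 := h4.trans_le (hbS S k)
        have h7 := hbS S k
        gcongr
        calc ‖a k‖ / ‖γ k‖ * (2 * (z k).re) / finiteBlaschke z S k
            ≤ ‖a k‖ / ‖γ k‖ * (2 * (z k).re) / b k := by gcongr
          _ = _ := by ring
      calc ‖F‖ ^ 2 ≤ ‖∑ k ∈ S, c k • cauchyKernel (conj (z k))‖ ^ 2 := by gcongr
        _ ≤ _ := h1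
        _ ≤ _ := by gcongr)
  obtain ⟨h', h1, -, h3⟩ := exists_causal_laplace_eq F
  refine ⟨h', h1, fun k => ?_⟩
  rw [h3, ← inner_cauchyKernel (hz k), hF k]
  have := hγ k
  field_simp

/-! ### Infinite Blaschke products as limits of finite ones -/

theorem pseudoHyperbolic_neg (z w : ℂ) : pseudoHyperbolic (-z) (-w) = pseudoHyperbolic z w := by
  rw [pseudoHyperbolic, pseudoHyperbolic, map_neg, ← neg_add, ← neg_sub', neg_div_neg_eq]

theorem pseudoHyperbolic_le_one {z w : ℂ} (hz : 0 < z.re) (hw : 0 < w.re) :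
    pseudoHyperbolic z w ≤ 1 := by
  rw [pseudoHyperbolic, norm_div, div_le_one (norm_pos_iff.2 (add_conj_ne_zero hz hw)),
    ← sq_le_sq₀ (norm_nonneg _) (norm_nonneg _), ← Complex.normSq_eq_norm_sq,
    ← Complex.normSq_eq_norm_sq, Complex.normSq_apply, Complex.normSq_apply]
  simp only [Complex.sub_re, Complex.sub_im, Complex.add_re, Complex.add_im, Complex.conj_re,
    Complex.conj_im]
  nlinarith [mul_pos hz hw]

/-- Partial products decrease as factors are added, so convergence is unconditional even when the
limit is `0`; hence `blaschkeProduct` is a true limit and never the default value of a divergent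
product. -/
theorem hasProd_iInf_of_le_one {κ : Type*} {f : κ → ℝ} (h0 : ∀ j, 0 ≤ f j) (h1 : ∀ j, f j ≤ 1) :
    HasProd f (⨅ s : Finset κ, ∏ j ∈ s, f j) := by
  classical
  refine tendsto_atTop_ciInf (fun s t hst => ?_)
    ⟨0, by rintro _ ⟨s, rfl⟩; exact Finset.prod_nonneg fun j _ => h0 j⟩
  rw [← Finset.prod_sdiff hst]
  exact mul_le_of_le_one_left (Finset.prod_nonneg fun j _ => h0 j)
    (Finset.prod_le_one (fun j _ => h0 j) fun j _ => h1 j)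

theorem hasProd_blaschkeProduct {ι : Type*} {z : ι → ℂ} (hz : ∀ k, 0 < (z k).re) (k : ι) :
    HasProd (fun j : {j : ι // j ≠ k} => pseudoHyperbolic (z j) (z k)) (blaschkeProduct z k) :=
  (hasProd_iInf_of_le_one (f := fun j : {j : ι // j ≠ k} => pseudoHyperbolic (z j) (z k))
    (fun _ => norm_nonneg _)
    fun j => pseudoHyperbolic_le_one (hz j) (hz k)).multipliable.hasProd

section Blaschke

variable {ι : Type*} [DecidableEq ι] {z : ι → ℂ}

theorem finiteBlaschke_eq_prod_subtype (z : ι → ℂ) (S : Finset ι) (k : ι) :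
    finiteBlaschke z S k
      = ∏ j ∈ S.subtype (· ≠ k), pseudoHyperbolic (z (j : ι)) (z k) := by
  rw [Finset.prod_subtype_eq_prod_filter (f := fun j => pseudoHyperbolic (z j) (z k)),
    Finset.filter_ne', finiteBlaschke]

theorem tendsto_finiteBlaschke (hz : ∀ k, 0 < (z k).re) (k : ι) :
    Tendsto (fun S => finiteBlaschke z S k) atTop (𝓝 (blaschkeProduct z k)) := by
  have h : Tendsto (fun S : Finset ι => S.subtype (· ≠ k)) atTop atTop := by
    refine tendsto_atTop_atTop.2 fun t => ⟨t.map (Function.Embedding.subtype _), fun S hS j hj => ?_⟩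
    rw [Finset.mem_subtype]
    exact hS (Finset.mem_map.2 ⟨j, hj, rfl⟩)
  simp only [finiteBlaschke_eq_prod_subtype]
  exact (hasProd_blaschkeProduct hz k).comp h

theorem finiteBlaschke_antitone (hz : ∀ k, 0 < (z k).re) (k : ι) :
    Antitone fun S => finiteBlaschke z S k := by
  intro S S' h
  simp only [finiteBlaschke]
  rw [← Finset.prod_sdiff (Finset.erase_subset_erase k h)]
  exact mul_le_of_le_one_left (Finset.prod_nonneg fun j _ => norm_nonneg _)
    (Finset.prod_le_one (fun j _ => norm_nonneg _) fun j _ => pseudoHyperbolic_le_one (hz j) (hz k))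

theorem blaschkeProduct_le_finiteBlaschke (hz : ∀ k, 0 < (z k).re) (S : Finset ι) (k : ι) :
    blaschkeProduct z k ≤ finiteBlaschke z S k :=
  (finiteBlaschke_antitone hz k).le_of_tendsto (tendsto_finiteBlaschke hz k) S

theorem injective_of_blaschkeProduct_pos (hz : ∀ k, 0 < (z k).re)
    (hb : ∀ k, 0 < blaschkeProduct z k) : Function.Injective z := by
  intro j k hjk
  by_contra hne
  have h := (hb k).trans_le (blaschkeProduct_le_finiteBlaschke hz {j} k)
  have : finiteBlaschke z {j} k = 0 :=
    Finset.prod_eq_zero (Finset.mem_erase.2 ⟨hne, Finset.mem_singleton_self j⟩) (by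
      simp [pseudoHyperbolic, hjk])
  exact h.ne' this

/-- Interpolation forces the weighted Carleson condition, tested on reproducing kernels. -/
theorem sum_blaschkeProduct_le_of_interpolation {γ : ι → ℂ} (hz : ∀ k, 0 < (z k).re)
    (hinterp : ∀ a : lp (fun _ : ι => ℂ) 2, ∃ h : Lp ℂ 2 (volume : Measure ℝ),
      ∀ k, γ k * laplace h (z k) = a k) :
    (∀ k, 0 < blaschkeProduct z k) ∧ ∃ C > 0, ∀ (S : Finset ι) (w : ℂ), 0 < w.re →
      ∑ k ∈ S, (2 * (z k).re / blaschkeProduct z k / ‖z k + conj w‖ / ‖γ k‖) ^ 2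
        ≤ C / (2 * w.re) := by
  obtain ⟨C, hC, h⟩ := sum_le_of_interpolation hz hinterp
  have hγ : ∀ k, 0 < ‖γ k‖ := fun k => norm_pos_iff.2 (ne_zero_of_interpolation hinterp k)
  have hinj := injective_of_interpolation hinterp
  have hn : ∀ k {w : ℂ}, 0 < w.re → 0 < ‖z k + conj w‖ := fun k w hw =>
    norm_pos_iff.2 (add_conj_ne_zero (hz k) hw)
  have hpos : ∀ k, 0 < blaschkeProduct z k := by
    intro k
    set q := 2 * (z k).re / ‖z k + conj (1 : ℂ)‖ / ‖γ k‖ with hq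
    have hq0 : 0 < q := by
      have := hz k; have := hγ k; have := hn k (w := 1) (by simp)
      positivity
    -- One term of the kernel test at `w = 1` already bounds the finite products away from zero,
    -- uniformly in `S`.
    have hS : ∀ᶠ S in atTop, q / Real.sqrt C ≤ finiteBlaschke z S k := by
      filter_upwards [eventually_ge_atTop {k}] with S hkS
      have hk : k ∈ S := hkS (Finset.mem_singleton_self k)
      have hb := finiteBlaschke_pos (fun k _ => hz k) hinj.injOn hk
      have h1 := (Finset.single_le_sum (fun j _ => sq_nonneg _) hk).trans (h S 1 (by simp))
      have h2 : (q / finiteBlaschke z S k) ^ 2 ≤ C := by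
        refine le_trans (le_of_eq ?_) (h1.trans ?_)
        · rw [hq]; congr 1; ring
        · simp only [Complex.one_re]; linarith
      rw [div_le_iff₀ (Real.sqrt_pos.2 hC), mul_comm, ← div_le_iff₀ hb]
      exact Real.le_sqrt_of_sq_le h2
    exact (div_pos hq0 (Real.sqrt_pos.2 hC)).trans_le
      (ge_of_tendsto (tendsto_finiteBlaschke hz k) hS)
  refine ⟨hpos, C, hC, fun S w hw => ?_⟩
  have ht : Tendsto (fun S' : Finset ι =>
      ∑ k ∈ S, (2 * (z k).re / finiteBlaschke z S' k / ‖z k + conj w‖ / ‖γ k‖) ^ 2) atTop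
      (𝓝 (∑ k ∈ S, (2 * (z k).re / blaschkeProduct z k / ‖z k + conj w‖ / ‖γ k‖) ^ 2)) := by
    refine tendsto_finsetSum _ fun k _ => ?_
    exact (((tendsto_const_nhds.div (tendsto_finiteBlaschke hz k) (hpos k).ne').div_const _).div_const
      _).pow 2
  refine le_of_tendsto ht ?_
  filter_upwards [eventually_ge_atTop S] with S' hS'
  exact (Finset.sum_le_sum_of_subset_of_nonneg hS' fun _ _ _ => sq_nonneg _).trans (h S' w hw)

end Blaschke

/-! ### From kernel tests and squares to `WeightedCarleson` -/

theorem blaschkeProduct_neg {ι : Type*} (lam : ι → ℂ) (k : ι) :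
    blaschkeProduct (fun j => -lam j) k = blaschkeProduct lam k := by
  simp only [blaschkeProduct, pseudoHyperbolic_neg]

theorem abs_sub_le_of_ordConnected {I : Set ℝ} (hI : I.OrdConnected) {x y : ℝ} (hx : x ∈ I)
    (hy : y ∈ I) : ENNReal.ofReal |x - y| ≤ volume I := by
  rw [← Real.volume_interval, uIcc_comm]
  exact measure_mono (hI.uIcc_subset hx hy)

theorem carleson_term_eq {β b : ℝ} {μ g γ : ℂ} (hμ : μ.re < 0) (hb : 0 < b) (hg : g ≠ 0)
    (hγ : ‖γ‖ = ‖g‖ / ‖1 - μ‖ ^ β) :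
    ENNReal.ofReal (|2 * μ.re| ^ 2 * ‖1 - μ‖ ^ (2 * β)) / ENNReal.ofReal (|b| ^ 2 * ‖g‖ ^ 2)
      = ENNReal.ofReal ((2 * (-μ).re / b / ‖γ‖) ^ 2) := by
  have h1 : 0 < ‖1 - μ‖ := norm_pos_iff.2 fun h => by
    have := congrArg Complex.re h
    simp at this
    linarith
  have hg' := norm_pos_iff.2 hg
  have h2 : 0 < ‖1 - μ‖ ^ β := Real.rpow_pos_of_pos h1 _
  rw [← ENNReal.ofReal_div_of_pos (by positivity)]
  congr 1
  rw [hγ, sq_abs, sq_abs, mul_comm 2 β, Real.rpow_mul h1.le, Real.rpow_two, Complex.neg_re]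
  field_simp

theorem weightedCarleson_of_interpolation {ι : Type*} {lam g γ : ι → ℂ} {β : ℝ}
    (hlam : ∀ k, (lam k).re < 0) (hγ : ∀ k, ‖γ k‖ = ‖g k‖ / ‖1 - lam k‖ ^ β)
    (hinterp : ∀ a : lp (fun _ : ι => ℂ) 2, ∃ h : Lp ℂ 2 (volume : Measure ℝ),
      ∀ k, γ k * laplace h (-lam k) = a k) :
    WeightedCarleson lam g β := by
  classical
  have hz : ∀ k, 0 < (-lam k).re := fun k => by simpa using hlam k
  obtain ⟨hb, C, hC, h⟩ := sum_blaschkeProduct_le_of_interpolation hz hinterp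
  have hg : ∀ k, g k ≠ 0 := fun k h0 =>
    ne_zero_of_interpolation hinterp k (norm_eq_zero.1 (by rw [hγ, h0]; simp))
  refine ⟨(5 * C).toNNReal, Real.toNNReal_pos.2 (by positivity), fun I hI => ?_⟩
  have hκ : ((5 * C).toNNReal : ℝ≥0∞) ≠ 0 := by
    have := Real.toNNReal_pos.2 (show 0 < 5 * C by positivity)
    exact_mod_cast this.ne'
  by_cases htop : volume I = ∞
  · rw [htop, ENNReal.mul_top hκ]
    exact le_top
  rw [ENNReal.tsum_eq_iSup_sum]
  refine iSup_le fun s => ?_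
  rcases s.eq_empty_or_nonempty with rfl | ⟨k₀, -⟩
  · simp
  set L := (volume I).toReal with hL
  have hvol : volume I = ENNReal.ofReal L := (ENNReal.ofReal_toReal htop).symm
  have hL0 : 0 < L := by
    refine ENNReal.toReal_pos ?_ htop
    exact (lt_of_le_of_lt zero_le k₀.2.2.2).ne'
  -- The test point has height `L` over a node already in the square, which avoids endpoints of `I`.
  -- Every node of the square then satisfies `|z_k + conj w| ≤ 3L`, so the kernel test costs `9L² ·
  -- C/(2L)`, below `5CL`.
  let w : ℂ := ⟨L, (-lam k₀).im⟩
  have hw : 0 < w.re := hL0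
  have hdist : ∀ k : {k : ι // -lam k ∈ carlesonSquare I}, ‖-lam k + conj w‖ ≤ 3 * L := by
    intro k
    have h1 : (-lam k).re < L := by
      have := k.2.2.2
      rw [hvol] at this
      exact (ENNReal.ofReal_lt_ofReal_iff hL0).1 this
    have h2 : |(-lam k).im - (-lam k₀).im| ≤ L := by
      have := abs_sub_le_of_ordConnected hI k.2.1 k₀.2.1
      rw [hvol] at this
      exact (ENNReal.ofReal_le_ofReal_iff hL0.le).1 this
    have h3 := hz k
    have h4 := Complex.norm_le_abs_re_add_abs_im (-lam k + conj w)
    have h5 : (-lam k + conj w).re = (-lam k).re + L := by simp [w]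
    have h6 : (-lam k + conj w).im = (-lam k).im - (-lam k₀).im := by
      simp [w]
    rw [h5, h6, abs_of_pos (by linarith)] at h4
    linarith
  have hterm : ∀ k ∈ s, ENNReal.ofReal (|2 * (lam k).re| ^ 2 * ‖1 - lam k‖ ^ (2 * β)) /
      ENNReal.ofReal (|blaschkeProduct lam k| ^ 2 * ‖g k‖ ^ 2)
      ≤ ENNReal.ofReal (9 * L ^ 2 * (2 * (-lam k).re / blaschkeProduct (fun j => -lam j) k /
          ‖-lam k + conj w‖ / ‖γ k‖) ^ 2) := by
    intro k _
    have hbk := hb k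
    rw [carleson_term_eq (hlam k) (blaschkeProduct_neg lam k ▸ hbk) (hg k) (hγ k),
      ← blaschkeProduct_neg]
    apply ENNReal.ofReal_le_ofReal
    have hn : 0 < ‖-lam (k : ι) + conj w‖ := norm_pos_iff.2 (add_conj_ne_zero (hz k) hw)
    have h1 : 1 ≤ (3 * L / ‖-lam (k : ι) + conj w‖) ^ 2 :=
      one_le_pow₀ ((one_le_div hn).2 (hdist k))
    calc _ ≤ (2 * (-lam (k : ι)).re / blaschkeProduct (fun j => -lam j) k / ‖γ k‖) ^ 2 *
          (3 * L / ‖-lam (k : ι) + conj w‖) ^ 2 := le_mul_of_one_le_right (sq_nonneg _) h1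
      _ = _ := by ring
  refine (Finset.sum_le_sum hterm).trans ?_
  rw [← ENNReal.ofReal_sum_of_nonneg (fun _ _ => by positivity), ← Finset.mul_sum, hvol,
    show (((5 * C).toNNReal : ℝ≥0) : ℝ≥0∞) = ENNReal.ofReal (5 * C) from rfl,
    ← ENNReal.ofReal_mul (by positivity)]
  apply ENNReal.ofReal_le_ofReal
  have h1 := h (s.map (Function.Embedding.subtype _)) w hw
  rw [Finset.sum_map] at h1
  calc _ ≤ 9 * L ^ 2 * (C / (2 * L)) := by
        gcongr
        exact h1
    _ = 9 / 2 * C * L := by field_simp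
    _ ≤ _ := by nlinarith [mul_pos hC hL0]

theorem exists_interpolant_of_weightedCarleson {ι : Type*} {lam g γ : ι → ℂ} {β : ℝ}
    (hlam : ∀ k, (lam k).re < 0) (hγ : ∀ k, ‖γ k‖ = ‖g k‖ / ‖1 - lam k‖ ^ β)
    (hW : WeightedCarleson lam g β) :
    (∀ k, g k ≠ 0) ∧ ∀ a : lp (fun _ : ι => ℂ) 2, ∃ h : Lp ℂ 2 (volume : Measure ℝ),
      IsCausal h ∧ ∀ k, γ k * laplace h (-lam k) = a k := by
  classical
  have hz : ∀ k, 0 < (-lam k).re := fun k => by simpa using hlam k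
  have h1 : ∀ k, 0 < ‖1 - lam k‖ := fun k => norm_pos_iff.2 fun h => by
    have := congrArg Complex.re h
    have := hlam k
    simp at *
    linarith
  obtain ⟨κ, hκ, h⟩ := hW
  have hden : ∀ k, blaschkeProduct lam k ≠ 0 ∧ g k ≠ 0 := by
    intro k
    -- This square, of side twice the real part, contains the node. Its sum is finite, which rules
    -- out a vanishing denominator.
    set I : Set ℝ := Icc ((-lam k).im - (-lam k).re) ((-lam k).im + (-lam k).re)
    have hk0 := hz k
    have hvol : volume I = ENNReal.ofReal (2 * (-lam k).re) := by
      rw [Real.volume_Icc]; ring_nf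
    have hk : -lam k ∈ carlesonSquare I := by
      refine ⟨⟨by linarith, by linarith⟩, hk0, ?_⟩
      rw [hvol]
      exact (ENNReal.ofReal_lt_ofReal_iff (by linarith)).2 (by linarith)
    have h2 := (ENNReal.le_tsum (f := fun k : {k : ι // -lam k ∈ carlesonSquare I} =>
      ENNReal.ofReal (|2 * (lam k).re| ^ 2 * ‖1 - lam k‖ ^ (2 * β)) /
          ENNReal.ofReal (|blaschkeProduct lam k| ^ 2 * ‖g k‖ ^ 2)) ⟨k, hk⟩).trans
      (h I ordConnected_Icc)
    by_contra hcon
    have h3 : |blaschkeProduct lam k| ^ 2 * ‖g k‖ ^ 2 = 0 := by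
      rw [not_and_or, not_not, not_not] at hcon
      rcases hcon with h0 | h0 <;> simp [h0]
    have h4 : 0 < |2 * (lam k).re| ^ 2 * ‖1 - lam k‖ ^ (2 * β) := by
      have := abs_pos.2 (mul_ne_zero two_ne_zero (hlam k).ne)
      have := Real.rpow_pos_of_pos (h1 k) (2 * β)
      positivity
    simp only [h3, ENNReal.ofReal_zero] at h2
    rw [ENNReal.div_zero (ENNReal.ofReal_pos.2 h4).ne', hvol, top_le_iff] at h2
    exact ENNReal.mul_ne_top ENNReal.coe_ne_top ENNReal.ofReal_ne_top h2
  have hb : ∀ k, 0 < blaschkeProduct (fun j => -lam j) k := fun k =>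
    lt_of_le_of_ne (ge_of_tendsto' (tendsto_finiteBlaschke hz k)
      fun S => Finset.prod_nonneg fun _ _ => norm_nonneg _)
      (by rw [blaschkeProduct_neg]; exact (hden k).1.symm)
  have hγ0 : ∀ k, γ k ≠ 0 := fun k => norm_ne_zero_iff.1 (by
    rw [hγ]
    exact div_ne_zero (norm_ne_zero_iff.2 (hden k).2) (Real.rpow_pos_of_pos (h1 k) _).ne')
  refine ⟨fun k => (hden k).2, fun a => exists_interpolant hz hγ0
    (injective_of_blaschkeProduct_pos hz hb) hb (blaschkeProduct_le_finiteBlaschke hz)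
    κ.coe_nonneg (fun S c L hL => ?_) a⟩
  set I : Set ℝ := Icc (c - L) (c + L) with hI
  have hvol : volume I = ENNReal.ofReal (2 * L) := by
    rw [Real.volume_Icc]; ring_nf
  have hmem : ∀ k, |(-lam k).im - c| ≤ L ∧ (-lam k).re < 2 * L → -lam k ∈ carlesonSquare I := by
    rintro k ⟨h2, h3⟩
    rw [abs_le] at h2
    refine ⟨⟨by linarith, by linarith⟩, hz k, ?_⟩
    rw [hvol]
    exact (ENNReal.ofReal_lt_ofReal_iff (by linarith)).2 h3
  have h2 := (ENNReal.sum_le_tsum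
    ((S.filter fun k => |(-lam k).im - c| ≤ L ∧ (-lam k).re < 2 * L).subtype
      fun k => -lam k ∈ carlesonSquare I)).trans (h I ordConnected_Icc)
  rw [Finset.sum_subtype_of_mem (f := fun k =>
    ENNReal.ofReal (|2 * (lam k).re| ^ 2 * ‖1 - lam k‖ ^ (2 * β)) /
          ENNReal.ofReal (|blaschkeProduct lam k| ^ 2 * ‖g k‖ ^ 2))
      (fun k hk => hmem k (Finset.mem_filter.1 hk).2),
    Finset.sum_congr rfl fun k _ => carleson_term_eq (hlam k)
      (blaschkeProduct_neg lam k ▸ hb k) (hden k).2 (hγ k),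
    ← ENNReal.ofReal_sum_of_nonneg (fun _ _ => sq_nonneg _), hvol,
    ← ENNReal.ofReal_coe_nnreal, ← ENNReal.ofReal_mul κ.coe_nonneg] at h2
  have h3 := (ENNReal.ofReal_le_ofReal_iff (by positivity)).1 h2
  simp only [blaschkeProduct_neg]
  exact h3

/-! ### Riesz bases and coordinates in `ℓ²` -/

section Riesz

variable {ι H : Type*} [NormedAddCommGroup H] [InnerProductSpace ℂ H] {φ : ι → H}

theorem IsRieszBasis.exists_bounds (hφ : IsRieszBasis φ) :
    ∃ c > 0, ∃ C > 0, ∀ (S : Finset ι) (a : ι → ℂ),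
      c * (∑ k ∈ S, ‖a k‖ ^ 2) ≤ ‖∑ k ∈ S, a k • φ k‖ ^ 2 ∧
        ‖∑ k ∈ S, a k • φ k‖ ^ 2 ≤ C * (∑ k ∈ S, ‖a k‖ ^ 2) := by
  classical
  obtain ⟨-, c, hc, C, hC, h⟩ := hφ
  refine ⟨c, hc, C, hC, fun S a => ?_⟩
  have h1 := h (Finsupp.indicator S fun k _ => a k)
  have hsub := Finsupp.support_indicator_subset S fun k _ => a k
  have hval : ∀ k ∈ S, Finsupp.indicator S (fun k _ => a k) k = a k := fun k hk =>
    Finsupp.indicator_of_mem hk _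
  rw [Finset.sum_subset hsub (fun k _ hk => by rw [Finsupp.notMem_support_iff.1 hk]; simp),
    Finset.sum_subset hsub (fun k _ hk => by rw [Finsupp.notMem_support_iff.1 hk]; simp),
    Finset.sum_congr rfl (fun k hk => by rw [hval k hk]),
    Finset.sum_congr (g := fun k => a k • φ k) rfl (fun k hk => by rw [hval k hk])] at h1
  exact h1

/-- A Riesz basis gives an isomorphism of `ℓ²` with the space. -/
theorem IsRieszBasis.exists_equiv [CompleteSpace H] (hφ : IsRieszBasis φ) :
    ∃ Θ : lp (fun _ : ι => ℂ) 2 ≃L[ℂ] H, ∀ a, HasSum (fun k => a k • φ k) (Θ a) := by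
  classical
  obtain ⟨c, hc, C, hC, h⟩ := hφ.exists_bounds
  have hsum : ∀ a : lp (fun _ : ι => ℂ) 2, Summable fun k => a k • φ k := by
    intro a
    rw [summable_iff_vanishing_norm]
    intro ε hε
    obtain ⟨s, hs⟩ := summable_iff_vanishing_norm.1 (lp_two_norm_sq a).summable (ε ^ 2 / C)
      (by positivity)
    refine ⟨s, fun t ht => ?_⟩
    have h1 := hs t ht
    rw [Real.norm_eq_abs, abs_of_nonneg (Finset.sum_nonneg fun _ _ => by positivity),
      lt_div_iff₀ hC, mul_comm] at h1
    exact lt_of_pow_lt_pow_left₀ 2 hε.le ((h t fun k => a k).2.trans_lt h1)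
  have hbd : ∀ a : lp (fun _ : ι => ℂ) 2, c * ‖a‖ ^ 2 ≤ ‖∑' k, a k • φ k‖ ^ 2 ∧
      ‖∑' k, a k • φ k‖ ^ 2 ≤ C * ‖a‖ ^ 2 := by
    intro a
    have h1 : Tendsto (fun S : Finset ι => ‖∑ k ∈ S, a k • φ k‖ ^ 2) atTop
        (𝓝 (‖∑' k, a k • φ k‖ ^ 2)) := ((hsum a).hasSum.norm).pow 2
    have h2 : Tendsto (fun S : Finset ι => ∑ k ∈ S, ‖a k‖ ^ 2) atTop (𝓝 (‖a‖ ^ 2)) :=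
      lp_two_norm_sq a
    exact ⟨le_of_tendsto_of_tendsto' (h2.const_mul c) h1 fun S => (h S fun k => a k).1,
      le_of_tendsto_of_tendsto' h1 (h2.const_mul C) fun S => (h S fun k => a k).2⟩
  let Θ₀ : lp (fun _ : ι => ℂ) 2 →ₗ[ℂ] H :=
    { toFun := fun a => ∑' k, a k • φ k
      map_add' := fun a b => by
        rw [← (hsum a).tsum_add (hsum b)]
        simp only [lp.coeFn_add, Pi.add_apply, add_smul]
      map_smul' := fun r a => by
        rw [RingHom.id_apply, ← (hsum a).tsum_const_smul]
        simp only [lp.coeFn_smul, Pi.smul_apply, smul_eq_mul, mul_smul] }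
  let Θ : lp (fun _ : ι => ℂ) 2 →L[ℂ] H := Θ₀.mkContinuous (Real.sqrt C) fun a => by
    rw [← Real.sqrt_sq (norm_nonneg a), ← Real.sqrt_mul hC.le]
    exact Real.le_sqrt_of_sq_le (hbd a).2
  have hΘ : ∀ a, HasSum (fun k => a k • φ k) (Θ a) := fun a => (hsum a).hasSum
  -- The lower Riesz bound gives injectivity and closed range; the dense span then makes the range
  -- everything.
  have hanti : AntilipschitzWith (Real.sqrt c⁻¹).toNNReal Θ := by
    refine AddMonoidHomClass.antilipschitz_of_bound Θ fun a => ?_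
    rw [Real.coe_toNNReal _ (Real.sqrt_nonneg _), ← Real.sqrt_sq (norm_nonneg (Θ a)),
      ← Real.sqrt_mul (by positivity)]
    apply Real.le_sqrt_of_sq_le
    rw [← div_eq_inv_mul, le_div_iff₀ hc, mul_comm]
    exact (hbd a).1
  have hinj : Θ.ker = ⊥ := LinearMap.ker_eq_bot.2 hanti.injective
  have hrange : Θ.range = ⊤ := by
    have hcl : IsClosed (Θ.range : Set H) := hanti.isClosed_range Θ.uniformContinuous
    rw [eq_top_iff, ← hφ.1]
    refine Submodule.topologicalClosure_minimal _ (Submodule.span_le.2 ?_) hcl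
    rintro _ ⟨k, rfl⟩
    refine ⟨lp.single 2 k 1, (hΘ _).unique ?_⟩
    have := hasSum_single (f := fun j => (lp.single (E := fun _ : ι => ℂ) 2 k 1) j • φ j) k
      (fun j hj => by rw [lp.single_apply_ne _ _ _ hj, zero_smul])
    simpa using this
  exact ⟨ContinuousLinearEquiv.ofBijective Θ hinj hrange, hΘ⟩

end Riesz

/-! ### Semigroups, eigenvectors and the diagonal input map -/

/-- A family of operators with exponential decay, applied to an expansion in common
eigenvectors and integrated against an `L²` function. -/
theorem hasSum_integral_of_eigenvectors {ι E : Type*} [Countable ι] [NormedAddCommGroup E]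
    [NormedSpace ℂ E] [CompleteSpace E] {U : ℝ → E → E} (hUl : ∀ t, IsLinearMap ℂ (U t))
    {M ω : ℝ} (hM : 0 < M) (hω : 0 < ω)
    (hU : ∀ t f, 0 < t → ‖U t f‖ ≤ M * Real.exp (-ω * t) * ‖f‖) {lam g : ι → ℂ} {e : ι → E} {b : E}
    (hlam : ∀ k, (lam k).re < 0)
    (he : ∀ k t, 0 < t → U t (e k) = Complex.exp (lam k * t) • e k)
    (hg : HasSum (fun k => g k • e k) b) (u : Lp ℂ 2 (volume : Measure ℝ)) :
    HasSum (fun k => (g k * laplace u (-lam k)) • e k) (∫ t in Ioi (0 : ℝ), u t • U t b) := by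
  have hUs : ∀ (t : ℝ) (S : Finset ι), U t (∑ k ∈ S, g k • e k) = ∑ k ∈ S, U t (g k • e k) :=
    fun t S => map_sum ((hUl t).mk' (U t)) _ S
  have hmode : ∀ k, ∀ t ∈ Ioi (0 : ℝ),
      u t • U t (g k • e k) = (u t * Complex.exp (-(-lam k) * t)) • g k • e k := fun k t ht => by
    rw [(hUl t).map_smul, he k t ht, neg_neg, smul_comm (g k), smul_smul]
  have hinterp : ∀ k, IntegrableOn (fun t : ℝ => u t * Complex.exp (-(-lam k) * t)) (Ioi 0) :=
    fun k => integrableOn_mul_exp_Ioi (by simpa using hlam k) u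
  have hmodeI : ∀ k, IntegrableOn (fun t : ℝ => u t • U t (g k • e k)) (Ioi 0) :=
    fun k => IntegrableOn.congr_fun (Integrable.smul_const (hinterp k) (g k • e k))
      (fun t ht => (hmode k t ht).symm) measurableSet_Ioi
  have hbound := (integrableOn_mul_exp_Ioi (z := (ω : ℂ)) (by simpa using hω) u).norm.const_mul
    (M * (‖b‖ + 1))
  -- Dominated convergence along finite index sets, for which `ι` must be countable. Measurability
  -- is needed only for the partial sums, which are explicit exponentials, so no strong continuity
  -- of `U` enters; eventually the partial sums have norm at most `‖b‖ + 1`.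
  have key := tendsto_integral_filter_of_dominated_convergence (l := atTop)
    (μ := volume.restrict (Ioi (0 : ℝ)))
    (F := fun (S : Finset ι) t => u t • U t (∑ k ∈ S, g k • e k))
    (f := fun t => u t • U t b) _ ?_ ?_ hbound ?_
  · refine key.congr fun S => ?_
    simp only [hUs, Finset.smul_sum]
    rw [integral_finsetSum _ fun k _ => hmodeI k]
    refine Finset.sum_congr rfl fun k _ => ?_
    rw [setIntegral_congr_fun measurableSet_Ioi (hmode k), integral_smul_const, smul_smul,
      mul_comm, laplace]
  · refine Eventually.of_forall fun S => ?_
    simp only [hUs, Finset.smul_sum]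
    exact (integrable_finsetSum _ fun k _ => hmodeI k).aestronglyMeasurable
  · have hn : ∀ᶠ S : Finset ι in atTop, ‖∑ k ∈ S, g k • e k‖ ≤ ‖b‖ + 1 :=
      (hg.norm.eventually (gt_mem_nhds (lt_add_one _))).mono fun S hS => le_of_lt hS
    filter_upwards [hn] with S hS
    filter_upwards [ae_restrict_mem measurableSet_Ioi] with t ht
    rw [norm_smul, norm_mul, Complex.norm_exp]
    have e1 : (-(ω : ℂ) * t).re = -ω * t := by simp
    rw [e1]
    calc _ ≤ ‖u t‖ * ((M * Real.exp (-ω * t)) * (‖b‖ + 1)) := by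
          gcongr
          exact (hU t _ ht).trans (by gcongr)
      _ = _ := by ring
  · filter_upwards [ae_restrict_mem measurableSet_Ioi] with t ht
    have hc : Continuous (U t) :=
      (((hUl t).mk' (U t)).mkContinuous _ fun f => hU t f ht).continuous
    exact ((hc.tendsto _).comp hg).const_smul (u t)

section Semigroup

variable {H : Type*} [NormedAddCommGroup H] [InnerProductSpace ℂ H] [CompleteSpace H]
  {A : H →ₗ.[ℂ] H} {T : C0Semigroup H}

theorem IsGenerator.hasDerivWithinAt (hA : IsGenerator A T) {x : H} {μ : ℂ}
    (hx : (x, μ • x) ∈ A.graph) {t : ℝ} (ht : 0 ≤ t) :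
    HasDerivWithinAt (fun s : ℝ => T.toFun s.toNNReal x) (μ • T.toFun t.toNNReal x) (Ici t) t := by
  have h1 := hA.semigroup_mem_graph t.toNNReal hx
  rw [map_smul, hA] at h1
  rw [← hasDerivWithinAt_Ioi_iff_Ici, hasDerivWithinAt_iff_tendsto_slope' (by simp)]
  have h2 : Tendsto (fun s : ℝ => (s - t).toNNReal) (𝓝[>] t) (𝓝[>] 0) := by
    refine tendsto_nhdsWithin_iff.2 ⟨?_, ?_⟩
    · refine ((continuous_real_toNNReal.comp (continuous_sub_right t)).tendsto' t 0 ?_).mono_left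
        nhdsWithin_le_nhds
      simp
    · filter_upwards [self_mem_nhdsWithin] with s hs
      exact Real.toNNReal_pos.2 (sub_pos.2 hs)
  refine (h1.comp h2).congr' ?_
  filter_upwards [self_mem_nhdsWithin] with s hs
  have hs : t < s := hs
  have e : T.toFun s.toNNReal x = T.toFun (s - t).toNNReal (T.toFun t.toNNReal x) := by
    rw [← ContinuousLinearMap.comp_apply, ← T.map_add,
      ← Real.toNNReal_add (sub_nonneg.2 hs.le) ht, sub_add_cancel]
  simp only [Function.comp_apply, slope_def_module, e, Real.coe_toNNReal _ (sub_nonneg.2 hs.le)]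

/-- The function `e^{-μs} T(s)x` has vanishing right derivative, which is all the generator provides
and is enough for a continuous function to be constant. -/
theorem IsGenerator.apply_eigenvector (hA : IsGenerator A T) {x : H} {μ : ℂ}
    (hx : (x, μ • x) ∈ A.graph) {t : ℝ} (ht : 0 ≤ t) :
    T.toFun t.toNNReal x = Complex.exp (μ * t) • x := by
  have hcont : Continuous fun s : ℝ => T.toFun s.toNNReal x :=
    (T.strongly_continuous x).comp continuous_real_toNNReal
  have h := constant_of_has_deriv_right_zero (a := 0) (b := t)
    (f := fun s : ℝ => Complex.exp (-μ * s) • T.toFun s.toNNReal x)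
    (Continuous.continuousOn (by fun_prop)) (fun s hs => by
      have h1 := hA.hasDerivWithinAt hx hs.1
      have h2 : HasDerivAt (fun s : ℝ => Complex.exp (-μ * s)) (Complex.exp (-μ * s) * -μ) s := by
        have : HasDerivAt (fun s : ℝ => -μ * (s : ℂ)) (-μ) s := by
          simpa using (Complex.ofRealCLM.hasDerivAt (x := s)).const_mul (-μ)
        exact this.cexp
      have h3 := h2.hasDerivWithinAt.smul h1
      have e : Complex.exp (-μ * s) • μ • T.toFun s.toNNReal x
          + (Complex.exp (-μ * s) * -μ) • T.toFun s.toNNReal x = 0 := by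
        rw [smul_smul, ← add_smul]
        simp
      rw [e] at h3
      exact h3) t (right_mem_Icc.2 ht)
  simp only [Complex.ofReal_zero, mul_zero, Complex.exp_zero, Real.toNNReal_zero, one_smul,
    T.map_zero, ContinuousLinearMap.id_apply] at h
  conv_rhs => rw [← h]
  rw [smul_smul, ← Complex.exp_add]
  simp

/-- The embedding of the state space into the extrapolation space as a bounded map. -/
def embedCLM (A : H →ₗ.[ℂ] H) : H →L[ℂ] Extrapolation A :=
  LinearMap.mkContinuous
    { toFun := embed A
      map_add' := fun x y => by ext p; simp [embed_apply]
      map_smul' := fun r x => by ext p; simp [embed_apply] } 1 fun x => by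
    rw [one_mul]
    refine ContinuousLinearMap.opNorm_le_bound _ (norm_nonneg x) fun y => ?_
    change ‖embed A x y‖ ≤ _
    rw [embed_apply]
    calc _ ≤ ‖y.1.1‖ * ‖x‖ := norm_inner_le_norm _ _
      _ ≤ ‖x‖ * ‖y‖ := by
        rw [mul_comm]
        gcongr
        exact norm_fst_le y.1

theorem embedCLM_apply (x : H) : embedCLM A x = embed A x := rfl

theorem isLinearMap_extendedSemigroup (hA : IsGenerator A T) (t : ℝ≥0) :
    IsLinearMap ℂ (extendedSemigroup hA t) :=
  ⟨fun _ _ => by ext; rfl, fun _ _ => by ext; rfl⟩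

/-- The adjoint semigroup acts on both components of the graph of `A*`, so its graph norm is at most
`‖T(t)‖`. This carries exponential stability over to `D(A*)'`. -/
theorem norm_extendedSemigroup_le (hA : IsGenerator A T) (t : ℝ≥0) (f : Extrapolation A) :
    ‖extendedSemigroup hA t f‖ ≤ ‖T.toFun t‖ * ‖f‖ := by
  refine ContinuousLinearMap.opNorm_le_bound _ (by positivity) fun y => ?_
  change ‖f (adjointSemigroup hA t y)‖ ≤ _
  have h1 : ‖adjointSemigroup hA t y‖ ≤ ‖T.toFun t‖ * ‖y‖ := by
    have h2 : ∀ v : H, ‖(T.toFun t).adjoint v‖ ≤ ‖T.toFun t‖ * ‖v‖ := fun v => by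
      have := (T.toFun t).adjoint.le_opNorm v
      rwa [LinearIsometryEquiv.norm_map] at this
    change ‖((T.toFun t).adjoint y.1.1, (T.toFun t).adjoint y.1.2)‖ ≤ _
    rw [Prod.norm_mk]
    refine max_le ((h2 _).trans ?_) ((h2 _).trans ?_)
    · gcongr; exact norm_fst_le y.1
    · gcongr; exact norm_snd_le y.1
  calc _ ≤ ‖f‖ * ‖adjointSemigroup hA t y‖ := f.le_opNorm _
    _ ≤ ‖f‖ * (‖T.toFun t‖ * ‖y‖) := by gcongr
    _ = _ := by ring

/-- The input map acts diagonally on eigenvectors. -/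
theorem hasSum_inputMap {ι : Type*} [Countable ι] (hA : IsGenerator A T)
    (hT : T.ExponentiallyStable) {φ : ι → H} {lam g : ι → ℂ}
    (heig : ∀ k, (φ k, lam k • φ k) ∈ A.graph) (hlam : ∀ k, (lam k).re < 0)
    {B : ℂ →L[ℂ] Extrapolation A} (hg : HasSum (fun k => g k • embed A (φ k)) (B 1))
    (u : Lp ℂ 2 (volume : Measure ℝ)) :
    HasSum (fun k => (g k * laplace u (-lam k)) • embed A (φ k)) (inputMap hA B u) := by
  obtain ⟨M, hM, ω, hω, hT⟩ := hT
  have hB : ∀ t, extendedSemigroup hA (Real.toNNReal t) (B (u t))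
      = u t • extendedSemigroup hA t.toNNReal (B 1) := fun t => by
    rw [← (isLinearMap_extendedSemigroup hA _).map_smul, ← map_smul, smul_eq_mul, mul_one]
  have h1 : ∀ (t : ℝ) (f : Extrapolation A), 0 < t →
      ‖extendedSemigroup hA t.toNNReal f‖ ≤ M * Real.exp (-ω * t) * ‖f‖ := by
    intro t f ht
    have h := hT t.toNNReal
    rw [Real.coe_toNNReal _ ht.le] at h
    exact (norm_extendedSemigroup_le hA _ f).trans (by gcongr)
  have h2 : ∀ (k : ι) (t : ℝ), 0 < t → extendedSemigroup hA t.toNNReal (embed A (φ k))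
      = Complex.exp (lam k * t) • embed A (φ k) := by
    intro k t ht
    rw [extendedSemigroup_embed, hA.apply_eigenvector (heig k) ht.le, ← embedCLM_apply, map_smul,
      embedCLM_apply]
  have h3 : inputMap hA B u = ∫ t in Ioi (0 : ℝ), u t • extendedSemigroup hA t.toNNReal (B 1) := by
    unfold inputMap
    congr 1
    funext t
    exact hB t
  have h4 := hasSum_integral_of_eigenvectors (E := Extrapolation A) (g := g) (b := B 1)
    (U := fun t => extendedSemigroup hA t.toNNReal)
    (fun t => isLinearMap_extendedSemigroup hA t.toNNReal) hM hω h1 hlam h2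
  have h5 := h4 hg u
  rw [h3]
  exact h5

/-- A functional that is multiplied by scalars under the semigroup is represented by an
eigenvector of the adjoint of the generator. -/
theorem mem_adjoint_graph_of_functional {ι : Type*} (hA : IsGenerator A T) {φ : ι → H}
    {lam : ι → ℂ} (heig : ∀ k, (φ k, lam k • φ k) ∈ A.graph)
    (hdense : (Submodule.span ℂ (range φ)).topologicalClosure = ⊤) {k : ι} {ψ : H}
    (hψk : inner ℂ ψ (φ k) = 1) (hψ : ∀ j, j ≠ k → inner ℂ ψ (φ j) = 0) :
    (ψ, conj (lam k) • ψ) ∈ A†.graph := by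
  have hspan : Submodule.span ℂ (range φ) ≤ A.domain := by
    refine Submodule.span_le.2 ?_
    rintro _ ⟨j, rfl⟩
    exact LinearPMap.mem_domain_of_mem_graph (heig j)
  have hd' : Dense (Submodule.span ℂ (range φ) : Set H) :=
    Submodule.dense_iff_topologicalClosure_eq_top.2 hdense
  have hd : Dense (A.domain : Set H) := hd'.mono hspan
  have hexp : ∀ j (t : ℝ≥0), T.toFun t (φ j) = Complex.exp (lam j * t) • φ j := fun j t => by
    have := hA.apply_eigenvector (heig j) t.2
    simpa using this
  have hsemi : ∀ (t : ℝ≥0) (x : H),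
      inner ℂ ψ (T.toFun t x) = Complex.exp (lam k * t) * inner ℂ ψ x := by
    intro t
    have : (innerSL ℂ ψ).comp (T.toFun t) = Complex.exp (lam k * t) • innerSL ℂ ψ := by
      refine ContinuousLinearMap.ext_on hd' ?_
      rintro _ ⟨j, rfl⟩
      change inner ℂ ψ (T.toFun t (φ j)) = Complex.exp (lam k * t) * inner ℂ ψ (φ j)
      rw [hexp, inner_smul_right]
      by_cases hj : j = k
      · rw [hj]
      · rw [hψ j hj, mul_zero, mul_zero]
    exact fun x => congrArg (fun f : H →L[ℂ] ℂ => f x) this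
  have hlim : ∀ {x y : H}, (x, y) ∈ A.graph →
      Tendsto (fun t : ℝ≥0 => ((t : ℝ)⁻¹ : ℂ) * ((Complex.exp (lam k * t) - 1) * inner ℂ ψ x))
        (𝓝[>] 0) (𝓝 (inner ℂ ψ y)) := by
    intro x y hxy
    rw [hA] at hxy
    refine ((innerSL ℂ ψ).continuous.tendsto y |>.comp hxy).congr fun t => ?_
    change inner ℂ ψ ((t : ℝ)⁻¹ • (T.toFun t x - x)) = _
    rw [← Complex.coe_smul, inner_smul_right, inner_sub_right, hsemi]
    push_cast; ring
  -- At `x = φ_k` the limit is the derivative of `e^{λ_k t}` at `0`, namely `λ_k`; it is reused for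
  -- every `x` in the domain.
  have h1 := hlim (heig k)
  rw [inner_smul_right, hψk, mul_one] at h1
  have key : ∀ x : A.domain, inner ℂ (conj (lam k) • ψ) (x : H) = inner ℂ ψ (A x) := by
    intro x
    rw [inner_smul_left, Complex.conj_conj]
    refine tendsto_nhds_unique ((h1.mul_const (inner ℂ ψ (x : H))).congr fun t => ?_)
      (hlim (A.mem_graph x))
    ring
  have hm := LinearPMap.mem_adjoint_domain_of_exists (T := A) ψ ⟨_, key⟩
  exact (LinearPMap.mem_graph_iff _).2 ⟨⟨ψ, hm⟩, rfl, LinearPMap.adjoint_apply_eq hd _ key⟩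

end Semigroup

end DiagonalControl

end

/-! ### The equivalence -/

open DiagonalControl ComplexConjugate MeasureTheory

theorem mainTheorem3 {ι H : Type*} [Countable ι]
    [NormedAddCommGroup H] [InnerProductSpace ℂ H] [CompleteSpace H]
    (β : ℝ) (hβ : 0 < β)
    (A : H →ₗ.[ℂ] H) (T : DiagonalControl.C0Semigroup H)
    (hA : DiagonalControl.IsGenerator A T) (hT : T.ExponentiallyStable)
    (φ : ι → H) (hφ : DiagonalControl.IsRieszBasis φ)
    (lam : ι → ℂ) (heig : ∀ k, (φ k, lam k • φ k) ∈ A.graph) (hlam : ∀ k, (lam k).re < 0)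
    (B : ℂ →L[ℂ] DiagonalControl.Extrapolation A)
    (g : ι → ℂ) (hg : HasSum (fun k => g k • DiagonalControl.embed A (φ k)) (B 1)) :
    DiagonalControl.ExactlyControllable hA B β ↔
      DiagonalControl.WeightedCarleson lam g β := by
  classical
  obtain ⟨Θ, hΘ⟩ := hφ.exists_equiv
  -- The Sobolev weight is absorbed into the interpolation weights, so the remaining problem
  -- concerns plain causal `L²` functions.
  let γ : ι → ℂ := fun k => g k * (1 + -lam k) ^ (-β : ℂ)
  have hz : ∀ k, 0 < (-lam k).re := fun k => by simpa using hlam k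
  have hγ : ∀ k, ‖γ k‖ = ‖g k‖ / ‖1 - lam k‖ ^ β := fun k => by
    rw [norm_mul, ← Complex.ofReal_neg, Complex.norm_cpow_real, Real.rpow_neg (norm_nonneg _),
      ← sub_eq_add_neg, div_eq_mul_inv]
  have hsum := hasSum_inputMap hA hT heig hlam hg
  constructor
  · intro hctrl
    refine weightedCarleson_of_interpolation hlam hγ fun a => ?_
    obtain ⟨u, hu, hux⟩ := hctrl ⟨Θ a, rfl⟩
    obtain ⟨h, -, hh⟩ := exists_isCausal_laplace_of_mem_sobolev hβ hu
    refine ⟨h, fun k => ?_⟩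
    -- The sum for the input map converges only in `D(A*)'`, so coefficients are read off by an
    -- element of `D(A*)`: the `k`-th coordinate functional, which is an eigenvector of `A*`.
    let ψ : H := (InnerProductSpace.toDual ℂ H).symm
      ((lp.evalCLM ℂ (fun _ : ι => ℂ) 2 k).comp (Θ.symm : H →L[ℂ] lp (fun _ : ι => ℂ) 2))
    have hψ : ∀ x, inner ℂ ψ x = Θ.symm x k := fun x =>
      InnerProductSpace.toDual_symm_apply
    have hφs : ∀ j, Θ.symm (φ j) = lp.single 2 j 1 := fun j => by
      rw [ContinuousLinearEquiv.symm_apply_eq]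
      refine HasSum.unique ?_ (hΘ _)
      have := hasSum_single (f := fun i => (lp.single (E := fun _ : ι => ℂ) 2 j 1) i • φ i) j
        (fun i hi => by rw [lp.single_apply_ne _ _ _ hi, zero_smul])
      simpa using this
    have hψ1 : inner ℂ ψ (φ k) = 1 := by rw [hψ, hφs, lp.single_apply_self]
    have hψ0 : ∀ j, j ≠ k → inner ℂ ψ (φ j) = 0 := fun j hj => by
      rw [hψ, hφs, lp.single_apply_ne _ _ _ hj.symm]
    let y : AdjointDomain A :=
      ⟨(ψ, conj (lam k) • ψ), mem_adjoint_graph_of_functional hA heig hφ.1 hψ1 hψ0⟩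
    have h1 := hsum u
    simp only at hux
    rw [hux] at h1
    let ev : Extrapolation A →+ ℂ :=
      { toFun := fun f => f y, map_zero' := rfl, map_add' := fun _ _ => rfl }
    have hev : Continuous ev := continuous_eval_const y
    have h2 := h1.map ev hev
    have h3 : HasSum (ev ∘ fun j => (g j * laplace u (-lam j)) • embed A (φ j))
        (g k * laplace u (-lam k)) := by
      have := hasSum_single (f := ev ∘ fun j => (g j * laplace u (-lam j)) • embed A (φ j)) k
        (fun j hj => by
          change (g j * laplace u (-lam j)) * inner ℂ ψ (φ j) = 0
          rw [hψ0 j hj, mul_zero])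
      convert this using 1
      change _ = (g k * laplace u (-lam k)) * inner ℂ ψ (φ k)
      rw [hψ1, mul_one]
    have h4 : g k * laplace u (-lam k) = inner ℂ ψ (Θ a) := h3.unique h2
    rw [hψ, ContinuousLinearEquiv.symm_apply_apply, hh _ (hz k)] at h4
    rw [← h4, mul_assoc]
  · intro hW
    obtain ⟨-, hinterp⟩ := exists_interpolant_of_weightedCarleson hlam hγ hW
    rintro _ ⟨x, rfl⟩
    obtain ⟨h, hc, hh⟩ := hinterp (Θ.symm x)
    obtain ⟨u, hu, hul⟩ := exists_mem_sobolev_laplace hβ hc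
    -- The expansion of `x` converges in `H`, hence in `D(A*)'`, and has the same terms as the
    -- series of the input map.
    refine ⟨u, hu, (hsum u).unique ?_⟩
    have h1 := (hΘ (Θ.symm x)).mapL (embedCLM A)
    rw [ContinuousLinearEquiv.apply_symm_apply, embedCLM_apply] at h1
    convert h1 using 2 with k
    rw [map_smul, embedCLM_apply, hul _ (hz k), ← mul_assoc, ← hh k]
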